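/- Let $\mathcal X$ be a standard Borel space (e.g. $\mathcal X\subseteq\mathbb R^d$ Borel), $k\ge 1$, $1\le\Lambda<\infty$. Consider full data $(X,Y(0),Y(1),A,U)$ with $X\in\mathcal X$, potential outcomes $Y(0),Y(1)\in\mathbb R$, treatment $A\in\{0,1\}$ and unobserved confounders $U\in\mathbb R^k$. A law $Q$ of the full data satisfies the marginal sensitivity model MSM$(\Lambda)$ if $(Y(0),Y(1))$ and $A$ are conditionally independent given $(X,U)$ under $Q$, and, $Q$-almost surely, $$\frac1\Lambda\le\frac{Q(A=1\mid X,U)/Q(A=0\mid X,U)}{Q(A=1\mid X)/Q(A=0\mid X)}\le\Lambda$$ (in particular all these probabilities are in $(0,1)$). Let $P_o$ satisfy MSM$(\Lambda)$, and let $P$ be the law under $P_o$ of the observed data $(X,Y,A)$, $Y=Y(A)$. Assume $\mathbb E[|Y|\mid X=x]<\infty$ for $P_X$-almost every $x$. Let $\mathcal P(\Lambda)$ be the set of all laws $Q$ on the full data space that satisfy MSM$(\Lambda)$ and under which $(X,Y(A),A)$ has law $P$. For $Q\in\mathcal P(\Lambda)$ put $\mu_Q(x,a)=\mathbb E_Q[Y(a)\mid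 X=x]$, and let $\mu^+_\Lambda(\cdot,a)$ and $\mu^-_\Lambda(\cdot,a)$ be the ($P_X$-essential) supremum and infimum of the functions $\mu_Q(\cdot,a)$, $Q\in\mathcal P(\Lambda)$. Let $e_a(x)=P(A=a\mid X=x)$, let $F(\cdot\mid x,a)$ be the CDF of $Y$ given $X=x$, $A=a$, let $$q^+_\Lambda(x,a)=\inf\{q:F(q\mid x,a)\ge\tfrac{\Lambda}{1+\Lambda}\},\qquad q^-_\Lambda(x,a)=\inf\{q:F(q\mid x,a)\ge\tfrac{1}{1+\Lambda}\},$$ and let $\mathrm{sgn}(t)=1$ if $t\ge0$ and $-1$ otherwise. Then, for each $a\in\{0,1\}$: 1. For every $Q\in\mathcal P(\Lambda)$, $\mathbb E_Q[|Y(a)|\mid X=x]<\infty$ for almost every $x$. There are distributions $P^+_{\mu,a},P^-_{\mu,a}\in\mathcal P(\Lambda)$ with $\mu_{P^\pm_{\mu,a}}(x,a)=\mu^\pm_\Lambda(x,a)$ for almost every $x$. 2. For either sign and for almost every $x$ at which $q^\pm_\Lambda(x,a)$ is an exact quantile, i.e. $P(Y<q^+_\Lambda(x,a)\mid X=x,A=a)=\frac{\Lambda}{1+\Lambda}$,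 respectively $P(Y<q^-_\Lambda(x,a)\mid X=x,A=a)=\frac{1}{1+\Lambda}$ (as holds whenever $F(\cdot\mid x,a)$ is continuous; if $\Lambda=1$ this is not required), the conditional expectation below is well defined and $$\mu^\pm_\Lambda(x,a)=\mathbb E\Big[Y\,\mathbf 1\{A=a\}\Big(1+\frac{1-e_a(X)}{e_a(X)}\,\Lambda^{\pm\mathrm{sgn}(Y-q^\pm_\Lambda(X,a))}\Big)\,\Big|\,X=x\Big].$$ -/

import Mathlib

open MeasureTheory ProbabilityTheory

noncomputable section

namespace SensitivityModel

/-- A full data point `(X, (Y(0), Y(1)), A, U)`: covariates, the pair of potential outcomes (indexed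
by the treatment, `true` being treatment `1` and `false` treatment `0`), the treatment received, and
the vector of unobserved confounders. -/
abbrev FullData (𝒳 : Type*) (k : ℕ) : Type _ := 𝒳 × (Bool → ℝ) × Bool × (Fin k → ℝ)

/-- An observed data point `(X, Y, A)`. -/
abbrev ObsData (𝒳 : Type*) : Type _ := 𝒳 × ℝ × Bool

section FullData

variable {𝒳 : Type*} {k : ℕ}

/-- The covariates `X`. -/
def covariate (o : FullData 𝒳 k) : 𝒳 := o.1

/-- The potential outcomes `a ↦ Y(a)`. -/
def potential (o : FullData 𝒳 k) : Bool → ℝ := o.2.1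

/-- The treatment `A`. -/
def treatment (o : FullData 𝒳 k) : Bool := o.2.2.1

/-- The pair `(X, U)`. -/
def confounders (o : FullData 𝒳 k) : 𝒳 × (Fin k → ℝ) := (o.1, o.2.2.2)

/-- The observed data `(X, Y, A)` with `Y = Y(A)`. -/
def observe (o : FullData 𝒳 k) : ObsData 𝒳 := (o.1, o.2.1 o.2.2.1, o.2.2.1)

variable [MeasurableSpace 𝒳]

lemma measurable_confounders : Measurable (confounders : FullData 𝒳 k → 𝒳 × (Fin k → ℝ)) := by
  unfold confounders; fun_prop

lemma measurable_observe : Measurable (observe : FullData 𝒳 k → ObsData 𝒳) := by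
  have h : Measurable (fun o : FullData 𝒳 k => o.2.1 o.2.2.1) := by
    have h' : (fun o : FullData 𝒳 k => o.2.1 o.2.2.1)
        = fun o => if o.2.2.1 = true then o.2.1 true else o.2.1 false := by
      funext o
      cases o.2.2.1 <;> simp
    rw [h']
    refine Measurable.ite ?_ (by fun_prop) (by fun_prop)
    exact (measurable_fst.comp (measurable_snd.comp measurable_snd)) (measurableSet_singleton true)
  unfold observe
  exact measurable_fst.prodMk (h.prodMk (by fun_prop))

/-- The law of the observed data `(X, Y, A)` when the full data has law `Q`. -/
def observedLaw (Q : ProbabilityMeasure (FullData 𝒳 k)) : ProbabilityMeasure (ObsData 𝒳) :=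
  Q.map measurable_observe.aemeasurable

/-- The true propensity score `P_Q(A = 1 | X = x, U = u)`. -/
def trueScore (Q : ProbabilityMeasure (FullData 𝒳 k)) (z : 𝒳 × (Fin k → ℝ)) : ℝ :=
  (condDistrib treatment confounders (Q : Measure (FullData 𝒳 k)) z).real {true}

/-- The nominal propensity score `P_Q(A = 1 | X = x)`. -/
def nominalScore (Q : ProbabilityMeasure (FullData 𝒳 k)) (x : 𝒳) : ℝ :=
  (condDistrib treatment covariate (Q : Measure (FullData 𝒳 k)) x).real {true}

/-- `(Y(0), Y(1))` and `A` are conditionally independent given `(X, U)` under `Q`. -/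
def LatentUnconfounded [StandardBorelSpace 𝒳] (Q : ProbabilityMeasure (FullData 𝒳 k)) : Prop :=
  CondIndepFun (MeasurableSpace.comap confounders inferInstance) measurable_confounders.comap_le
    potential treatment (Q : Measure (FullData 𝒳 k))

/-- The marginal sensitivity model with parameter `Λ`. With the convention `t / 0 = 0` the lower
bound `1 / Λ > 0` fails as soon as one of the two scores is `0` or `1`, so the odds ratio is, almost
surely, a genuine quotient of two positive finite odds. -/
structure MSM [StandardBorelSpace 𝒳] (Λ : ℝ) (Q : ProbabilityMeasure (FullData 𝒳 k)) : Prop where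
  latent_unconfounded : LatentUnconfounded Q
  odds_ratio : ∀ᵐ o ∂(Q : Measure (FullData 𝒳 k)),
    1 / Λ ≤ (trueScore Q (confounders o) / (1 - trueScore Q (confounders o)))
        / (nominalScore Q (covariate o) / (1 - nominalScore Q (covariate o))) ∧
      (trueScore Q (confounders o) / (1 - trueScore Q (confounders o)))
        / (nominalScore Q (covariate o) / (1 - nominalScore Q (covariate o))) ≤ Λ

/-- The uncertainty set `𝒫(Λ)`: the laws of the full data that satisfy the marginal sensitivity
model and induce the law `P` of the observed data. -/
def uncertaintySet [StandardBorelSpace 𝒳] (k : ℕ) (Λ : ℝ) (P : ProbabilityMeasure (ObsData 𝒳)) :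
    Set (ProbabilityMeasure (FullData 𝒳 k)) :=
  {Q | MSM Λ Q ∧ observedLaw Q = P}

/-- The conditional law of the potential outcome `Y(a)` given `X = x` under `Q`. -/
def potentialLaw (Q : ProbabilityMeasure (FullData 𝒳 k)) (x : 𝒳) (a : Bool) : Measure ℝ :=
  condDistrib (fun o => potential o a) covariate (Q : Measure (FullData 𝒳 k)) x

/-- The conditional mean `μ_Q(x, a) = E_Q[Y(a) | X = x]`. -/
def condMean (Q : ProbabilityMeasure (FullData 𝒳 k)) (x : 𝒳) (a : Bool) : ℝ :=
  ∫ y, y ∂(potentialLaw Q x a)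

end FullData

section ObsData

variable {𝒳 : Type*} [MeasurableSpace 𝒳] (P : ProbabilityMeasure (ObsData 𝒳))

/-- The law `P_X` of the covariates. -/
def covariateLaw : Measure 𝒳 := (P : Measure (ObsData 𝒳)).map (fun z => z.1)

/-- The conditional law of `Y` given `X = x`. -/
def outcomeLaw (x : 𝒳) : Measure ℝ :=
  condDistrib (fun z => z.2.1) (fun z => z.1) (P : Measure (ObsData 𝒳)) x

/-- The conditional law of `Y` given `X = x` and `A = a`. -/
def armLaw (x : 𝒳) (a : Bool) : Measure ℝ :=
  condDistrib (fun z => z.2.1) (fun z => (z.1, z.2.2)) (P : Measure (ObsData 𝒳)) (x, a)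

/-- The conditional law of `(Y, A)` given `X = x`. -/
def outcomeArmLaw (x : 𝒳) : Measure (ℝ × Bool) :=
  condDistrib (fun z => z.2) (fun z => z.1) (P : Measure (ObsData 𝒳)) x

/-- `e_a(x) = P(A = a | X = x)`. -/
def armScore (x : 𝒳) (a : Bool) : ℝ :=
  (condDistrib (fun z => z.2.2) (fun z => z.1) (P : Measure (ObsData 𝒳)) x).real {a}

/-- The conditional quantile `inf {q : F(q | x, a) ≥ p}`. -/
def armQuantile (p : ℝ) (x : 𝒳) (a : Bool) : ℝ := sInf {q : ℝ | p ≤ (armLaw P x a).real (Set.Iic q)}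

/-- `q⁺_Λ(x, a)`. -/
def upperQuantile (Λ : ℝ) (x : 𝒳) (a : Bool) : ℝ := armQuantile P (Λ / (1 + Λ)) x a

/-- `q⁻_Λ(x, a)`. -/
def lowerQuantile (Λ : ℝ) (x : 𝒳) (a : Bool) : ℝ := armQuantile P (1 / (1 + Λ)) x a

/-- The sign with `sgn 0 = 1`. -/
def sgn (t : ℝ) : ℤ := if 0 ≤ t then 1 else -1

/-- `Y 1{A = a} [1 + (1 - e_a(X)) / e_a(X) * Λ ^ sgn(Y - q⁺_Λ(X, a))]` at `X = x`, `(Y, A) = v`. -/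
def upperIntegrand (Λ : ℝ) (x : 𝒳) (a : Bool) (v : ℝ × Bool) : ℝ :=
  v.1 * (if v.2 = a then 1 else 0) *
    (1 + (1 - armScore P x a) / armScore P x a * Λ ^ sgn (v.1 - upperQuantile P Λ x a))

/-- `Y 1{A = a} [1 + (1 - e_a(X)) / e_a(X) * Λ ^ (-sgn(Y - q⁻_Λ(X, a)))]` at `X = x`,
`(Y, A) = v`. -/
def lowerIntegrand (Λ : ℝ) (x : 𝒳) (a : Bool) (v : ℝ × Bool) : ℝ :=
  v.1 * (if v.2 = a then 1 else 0) *
    (1 + (1 - armScore P x a) / armScore P x a * Λ ^ (-sgn (v.1 - lowerQuantile P Λ x a)))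

end ObsData

section Envelopes

variable {𝒳 : Type*} [MeasurableSpace 𝒳]

/-- `m` is (a version of) the supremum of the family `S` of functions on `𝒳` that are defined up to
`ν`-null sets, i.e. its supremum in the order "`≤` almost everywhere". -/
structure IsEssSup (ν : Measure 𝒳) (S : Set (𝒳 → ℝ)) (m : 𝒳 → ℝ) : Prop where
  measurable : Measurable m
  upper : ∀ f ∈ S, f ≤ᵐ[ν] m
  least : ∀ g : 𝒳 → ℝ, Measurable g → (∀ f ∈ S, f ≤ᵐ[ν] g) → m ≤ᵐ[ν] g

/-- `m` is (a version of) the infimum of the family `S` of functions on `𝒳` that are defined up to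
`ν`-null sets, i.e. its infimum in the order "`≤` almost everywhere". -/
structure IsEssInf (ν : Measure 𝒳) (S : Set (𝒳 → ℝ)) (m : 𝒳 → ℝ) : Prop where
  measurable : Measurable m
  lower : ∀ f ∈ S, m ≤ᵐ[ν] f
  greatest : ∀ g : 𝒳 → ℝ, Measurable g → (∀ f ∈ S, g ≤ᵐ[ν] f) → g ≤ᵐ[ν] m

variable [StandardBorelSpace 𝒳]

/-- The identified set `{μ_Q(·, a) : Q ∈ 𝒫(Λ)}`. -/
def identifiedSet (k : ℕ) (Λ : ℝ) (P : ProbabilityMeasure (ObsData 𝒳)) (a : Bool) :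
    Set (𝒳 → ℝ) :=
  {f | ∃ Q ∈ uncertaintySet k Λ P, f = fun x => condMean Q x a}

/-- `m` is (a version of) the sharp upper bound `μ⁺_Λ(·, a)`. -/
def IsSharpUpper (k : ℕ) (Λ : ℝ) (P : ProbabilityMeasure (ObsData 𝒳)) (a : Bool)
    (m : 𝒳 → ℝ) : Prop :=
  IsEssSup (covariateLaw P) (identifiedSet k Λ P a) m

/-- `m` is (a version of) the sharp lower bound `μ⁻_Λ(·, a)`. -/
def IsSharpLower (k : ℕ) (Λ : ℝ) (P : ProbabilityMeasure (ObsData 𝒳)) (a : Bool)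
    (m : 𝒳 → ℝ) : Prop :=
  IsEssInf (covariateLaw P) (identifiedSet k Λ P a) m

end Envelopes

end SensitivityModel

end

/-! Fix the arm `a`. Write `e` and `e'` for the conditional probabilities given `X` of treatment `a`
and of the other treatment, and `π` for the probability of treatment `a` given `(X, U)`. Latent
unconfoundedness gives `E[1{A = a} f(X, Y(a))] = E[π(X, U) f(X, Y(a))]`, and the left side is
observed. The odds-ratio bounds say exactly that `1 / π` lies between `(e + e' / Λ) / e` and `(e + Λ
e') / e`. Hence the law of `Y(a)` given `X` has a density `g` with respect to the observed law of
`Y` given `X`, `A = a`, with `e + e' / Λ ≤ g ≤ e + Λ e'` and total mass one (`MSM.exists_density`).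

Maximizing `∫ y g` under these constraints is a Neyman-Pearson problem: an optimal `g` takes the
lower bound below a threshold and the upper bound above it
(`integral_mul_le_integral_mul_of_threshold`). Writing `g = e + e' w`, the constraint becomes that
`w` has mean one. With values `1 / Λ` below and `Λ` above the `p`-quantile this forces `p / Λ + (1 -
p) Λ = 1`, so `p = Λ / (1 + Λ)`; exchanging the values gives `1 / (1 + Λ)` for the minimum. An atom
at the quantile is split by interpolating the weight there, so extremal weights exist without
continuity.

Conversely, every measurable `w` with values in `[1 / Λ, Λ]` and conditional mean one is realized
(`exists_mem_uncertaintySet`): let `Y(a)` itself be the confounder, with density `e + e' w`, and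
treat with probability `e / (e + e' w)`. The odds ratio is then `w` or `1 / w`, and the observed law
is unchanged. As the threshold weight is jointly measurable in `(x, y)`, one law attains the bound
at almost every `x` simultaneously, so the essential supremum is a maximum. At an exact quantile the
interpolation disappears and the closed formula results. -/

noncomputable section

namespace SensitivityModel

/-! ### Quantiles, threshold weights and the exchange inequality -/

section Quantile

/-- The quantile function at level `p` of a measure on the real line. -/
def quantile (μ : Measure ℝ) (p : ℝ) : ℝ := sInf {q : ℝ | p ≤ μ.real (Set.Iic q)}

variable {μ : Measure ℝ} [IsProbabilityMeasure μ] {p : ℝ}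

lemma nonempty_setOf_le_measureReal_Iic (hp : p < 1) :
    {q : ℝ | p ≤ μ.real (Set.Iic q)}.Nonempty := by
  have h := (tendsto_cdf_atTop μ).eventually (lt_mem_nhds hp)
  obtain ⟨q, hq⟩ := h.exists
  exact ⟨q, by rw [Set.mem_ofPred_eq, ← cdf_eq_real]; exact hq.le⟩

lemma bddBelow_setOf_le_measureReal_Iic (hp : 0 < p) :
    BddBelow {q : ℝ | p ≤ μ.real (Set.Iic q)} := by
  have h := (tendsto_cdf_atBot μ).eventually (gt_mem_nhds hp)
  obtain ⟨q, hq⟩ := h.exists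
  refine ⟨q, fun t ht => ?_⟩
  rw [Set.mem_ofPred_eq, ← cdf_eq_real] at ht
  by_contra! hlt
  exact absurd (monotone_cdf μ hlt.le) (by linarith)

lemma le_measureReal_Iic_of_quantile_lt (hp1 : p < 1) {t : ℝ} (ht : quantile μ p < t) :
    p ≤ μ.real (Set.Iic t) := by
  obtain ⟨q, hq, hqt⟩ := exists_lt_of_csInf_lt (nonempty_setOf_le_measureReal_Iic hp1) ht
  exact le_trans hq (measureReal_mono (Set.Iic_subset_Iic.2 hqt.le))

lemma le_measureReal_Iic_quantile (hp1 : p < 1) :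
    p ≤ μ.real (Set.Iic (quantile μ p)) := by
  have h := ((cdf μ).right_continuous (quantile μ p)).tendsto.mono_left
    (nhdsWithin_mono _ Set.Ioi_subset_Ici_self)
  rw [← cdf_eq_real]
  refine ge_of_tendsto h ?_
  filter_upwards [self_mem_nhdsWithin] with t ht
  rw [cdf_eq_real]
  exact le_measureReal_Iic_of_quantile_lt hp1 ht

/-- Right-continuity of the CDF makes the infimum attained. The equivalence yields both the bound on
the mass left of the quantile and the measurability of quantiles in a parameter. -/
lemma quantile_le_iff (hp0 : 0 < p) (hp1 : p < 1) {t : ℝ} :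
    quantile μ p ≤ t ↔ p ≤ μ.real (Set.Iic t) := by
  refine ⟨fun h => ?_, fun h => csInf_le (bddBelow_setOf_le_measureReal_Iic hp0) h⟩
  exact (le_measureReal_Iic_quantile hp1).trans (measureReal_mono (Set.Iic_subset_Iic.2 h))

lemma measureReal_Iio_quantile_le (hp0 : 0 < p) (hp1 : p < 1) :
    μ.real (Set.Iio (quantile μ p)) ≤ p := by
  obtain ⟨u, hu, hlt, htend⟩ := exists_seq_strictMono_tendsto (quantile μ p)
  have hU : Set.Iio (quantile μ p) = ⋃ n, Set.Iic (u n) := by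
    ext y
    simp only [Set.mem_Iio, Set.mem_iUnion, Set.mem_Iic]
    refine ⟨fun hy => ?_, fun ⟨n, hn⟩ => hn.trans_lt (hlt n)⟩
    obtain ⟨n, hn⟩ := (htend.eventually (lt_mem_nhds hy)).exists
    exact ⟨n, hn.le⟩
  have h : Filter.Tendsto (fun n => μ.real (Set.Iic (u n))) Filter.atTop
      (nhds (μ.real (Set.Iio (quantile μ p)))) := by
    rw [hU]
    have hm : Monotone fun n => Set.Iic (u n) :=
      fun m n hmn => Set.Iic_subset_Iic.2 (hu.monotone hmn)
    exact (ENNReal.tendsto_toReal (measure_ne_top _ _)).comp (tendsto_measure_iUnion_atTop hm)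
  refine le_of_tendsto h (Filter.Eventually.of_forall fun n => ?_)
  by_contra! hn
  exact absurd ((quantile_le_iff hp0 hp1).2 hn.le) (not_le.2 (hlt n))

/-- The share of the atom at the quantile that receives the weight `α` when the weights `α` and `β`
are put below and above the quantile. -/
def atomShare (μ : Measure ℝ) (p : ℝ) : ℝ :=
  (p - μ.real (Set.Iio (quantile μ p))) / μ.real {quantile μ p}

/-- The weight that equals `α` below the `p`-quantile, `β` above it, and is interpolated on the
atom at the quantile. -/
def thresholdWeight (μ : Measure ℝ) (p α β y : ℝ) : ℝ :=
  if y < quantile μ p then α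
  else if y = quantile μ p then β - atomShare μ p * (β - α) else β

lemma measureReal_Iic_eq_Iio_add (μ : Measure ℝ) [IsFiniteMeasure μ] (t : ℝ) :
    μ.real (Set.Iic t) = μ.real (Set.Iio t) + μ.real {t} := by
  rw [← Set.Iio_union_right, measureReal_union (by simp) (measurableSet_singleton t)]

/-- The level `p` lies between the masses of the open and the closed half-line at the quantile,
whose difference is the atom. For a null atom the quotient is `0` by convention, which is also in
the interval. -/
lemma atomShare_mem_Icc (hp0 : 0 < p) (hp1 : p < 1) : atomShare μ p ∈ Set.Icc 0 1 := by
  have h1 := measureReal_Iio_quantile_le (μ := μ) hp0 hp1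
  have h2 := le_measureReal_Iic_quantile (μ := μ) hp1
  rw [measureReal_Iic_eq_Iio_add] at h2
  exact ⟨div_nonneg (by linarith) measureReal_nonneg,
    div_le_one_of_le₀ (by linarith) measureReal_nonneg⟩

lemma atomShare_mul (hp0 : 0 < p) (hp1 : p < 1) :
    atomShare μ p * μ.real {quantile μ p} = p - μ.real (Set.Iio (quantile μ p)) := by
  have h1 := measureReal_Iio_quantile_le (μ := μ) hp0 hp1
  have h2 := le_measureReal_Iic_quantile (μ := μ) hp1
  rw [measureReal_Iic_eq_Iio_add] at h2
  -- Without an atom the two half-line masses agree and squeeze `p`, so both sides vanish.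
  rcases eq_or_ne (μ.real {quantile μ p}) 0 with h | h
  · rw [h] at h2 ⊢
    linarith
  · exact div_mul_cancel₀ _ h

lemma thresholdWeight_mem_Icc (hp0 : 0 < p) (hp1 : p < 1) {α β l u : ℝ}
    (hα : α ∈ Set.Icc l u) (hβ : β ∈ Set.Icc l u) (y : ℝ) :
    thresholdWeight μ p α β y ∈ Set.Icc l u := by
  obtain ⟨h0, h1⟩ := atomShare_mem_Icc (μ := μ) hp0 hp1
  unfold thresholdWeight
  split_ifs
  · exact hα
  · constructor <;> nlinarith [hα.1, hα.2, hβ.1, hβ.2]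
  · exact hβ

lemma measurable_thresholdWeight (μ : Measure ℝ) (p α β : ℝ) :
    Measurable (thresholdWeight μ p α β) := by
  unfold thresholdWeight
  exact Measurable.ite measurableSet_Iio measurable_const
    (Measurable.ite (measurableSet_singleton _) measurable_const measurable_const)

/-- The share of the atom is chosen so that total mass exactly `p` is charged with `α`, as if the
quantile were exact. -/
lemma integral_thresholdWeight (hp0 : 0 < p) (hp1 : p < 1) {α β : ℝ} :
    ∫ y, thresholdWeight μ p α β y ∂μ = p * α + (1 - p) * β := by
  have h : thresholdWeight μ p α β = fun y => β
      + (Set.Iio (quantile μ p)).indicator (fun _ => α - β) y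
      + ({quantile μ p} : Set ℝ).indicator (fun _ => - (atomShare μ p * (β - α))) y := by
    funext y
    simp only [thresholdWeight, Set.indicator, Set.mem_Iio, Set.mem_singleton_iff]
    split_ifs with h1 h2 h2
    · exact absurd h1 (by simp [h2])
    all_goals ring
  rw [h, integral_add, integral_add, integral_indicator_const _ measurableSet_Iio,
    integral_indicator_const _ (measurableSet_singleton _)]
  · simp only [integral_const, probReal_univ, smul_eq_mul, one_mul]
    linear_combination (α - β) * atomShare_mul (μ := μ) hp0 hp1
  · exact integrable_const _
  · exact (integrable_const _).indicator measurableSet_Iio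
  · exact (integrable_const _).add ((integrable_const _).indicator measurableSet_Iio)
  · exact (integrable_const _).indicator (measurableSet_singleton _)

/-- At an exact quantile no interpolation takes place. -/
lemma thresholdWeight_of_exact {μ : Measure ℝ} {α β : ℝ}
    (h : α = β ∨ μ.real (Set.Iio (quantile μ p)) = p) (y : ℝ) :
    thresholdWeight μ p α β y = if y < quantile μ p then α else β := by
  unfold thresholdWeight
  rcases h with h | h
  · simp [h]
  · simp [atomShare, h]

/-- Moving weight from below a threshold to above it increases the weighted mean. -/
lemma integral_mul_le_integral_mul_of_threshold {g h : ℝ → ℝ} (q : ℝ)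
    (hμ : Integrable (fun y => y) μ) {B : ℝ}
    (hg : AEStronglyMeasurable g μ) (hh : AEStronglyMeasurable h μ)
    (hgB : ∀ᵐ y ∂μ, |g y| ≤ B) (hhB : ∀ᵐ y ∂μ, |h y| ≤ B)
    (hlt : ∀ᵐ y ∂μ, y < q → h y ≤ g y) (hgt : ∀ᵐ y ∂μ, q < y → g y ≤ h y)
    (heq : ∫ y, g y ∂μ = ∫ y, h y ∂μ) :
    ∫ y, y * g y ∂μ ≤ ∫ y, y * h y ∂μ := by
  have ig : Integrable g μ := .of_bound hg B hgB
  have ih : Integrable h μ := .of_bound hh B hhB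
  have iyg : Integrable (fun y => y * g y) μ := hμ.mul_bdd hg hgB
  have iyh : Integrable (fun y => y * h y) μ := hμ.mul_bdd hh hhB
  -- Since `g` and `h` have equal integrals, `y` may be replaced by `y - q`; then `(y - q) * (h y -
  -- g y)` is nonnegative pointwise, whatever happens at `y = q`.
  have key : ∫ y, (y * g y - q * g y) ∂μ ≤ ∫ y, (y * h y - q * h y) ∂μ := by
    refine integral_mono_ae (iyg.sub (ig.const_mul q)) (iyh.sub (ih.const_mul q)) ?_
    filter_upwards [hlt, hgt] with y h1 h2
    rcases lt_trichotomy y q with hy | hy | hy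
    · nlinarith [h1 hy]
    · simp [hy]
    · nlinarith [h2 hy]
  rw [integral_sub iyg (ig.const_mul q), integral_sub iyh (ih.const_mul q),
    integral_const_mul, integral_const_mul, heq] at key
  linarith

end Quantile

/-! ### Joint measurability of the threshold weight -/

section MeasurableFamily

variable {𝒳 : Type*} [MeasurableSpace 𝒳] (κ : Kernel 𝒳 ℝ) [IsMarkovKernel κ] {p : ℝ}

lemma measurable_quantile (hp0 : 0 < p) (hp1 : p < 1) :
    Measurable fun x => quantile (κ x) p := by
  refine measurable_of_Iic fun t => ?_
  have : (fun x => quantile (κ x) p) ⁻¹' Set.Iic t = {x | p ≤ (κ x).real (Set.Iic t)} := by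
    ext x
    simp [quantile_le_iff hp0 hp1]
  rw [this]
  exact measurableSet_le measurable_const (κ.measurable_coe measurableSet_Iic).ennreal_toReal

/-- The half-line and the atom move with `x`; their masses are kernel masses of the sections of
measurable subsets of the product. -/
lemma measurable_atomShare (hp0 : 0 < p) (hp1 : p < 1) :
    Measurable fun x => atomShare (κ x) p := by
  have hq := measurable_quantile κ hp0 hp1
  have h1 : Measurable fun x => (κ x).real (Set.Iio (quantile (κ x) p)) :=
    (Kernel.measurable_kernel_prodMk_left (κ := κ) (t := {z : 𝒳 × ℝ | z.2 < quantile (κ z.1) p})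
      (measurableSet_lt measurable_snd (hq.comp measurable_fst))).ennreal_toReal
  have h2 : Measurable fun x => (κ x).real {quantile (κ x) p} :=
    (Kernel.measurable_kernel_prodMk_left (κ := κ) (t := {z : 𝒳 × ℝ | z.2 = quantile (κ z.1) p})
      (measurableSet_eq_fun measurable_snd (hq.comp measurable_fst))).ennreal_toReal
  exact (measurable_const.sub h1).div h2

lemma measurable_uncurry_thresholdWeight (hp0 : 0 < p) (hp1 : p < 1) (α β : ℝ) :
    Measurable fun z : 𝒳 × ℝ => thresholdWeight (κ z.1) p α β z.2 := by
  have hq : Measurable fun z : 𝒳 × ℝ => quantile (κ z.1) p :=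
    (measurable_quantile κ hp0 hp1).comp measurable_fst
  have hs : Measurable fun z : 𝒳 × ℝ => atomShare (κ z.1) p :=
    (measurable_atomShare κ hp0 hp1).comp measurable_fst
  unfold thresholdWeight
  exact Measurable.ite (measurableSet_lt measurable_snd hq) measurable_const
    (Measurable.ite (measurableSet_eq_fun measurable_snd hq)
      (measurable_const.sub (hs.mul_const _)) measurable_const)

end MeasurableFamily

/-! ### Disintegration of the observed law -/

section Disintegration

variable {𝒳 : Type*} [MeasurableSpace 𝒳] (P : ProbabilityMeasure (ObsData 𝒳))

instance isProbabilityMeasure_covariateLaw : IsProbabilityMeasure (covariateLaw P) :=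
  Measure.isProbabilityMeasure_map measurable_fst.aemeasurable

/-- The conditional law of `Y` given `X` and `A = a`, as a Markov kernel. -/
def armKernel (a : Bool) : Kernel 𝒳 ℝ :=
  (condDistrib (fun z => z.2.1) (fun z => (z.1, z.2.2)) (P : Measure (ObsData 𝒳))).comap
    (fun x => (x, a)) (by fun_prop)

instance isMarkovKernel_armKernel (a : Bool) : IsMarkovKernel (armKernel P a) := by
  unfold armKernel; infer_instance

instance isProbabilityMeasure_armLaw (x : 𝒳) (a : Bool) : IsProbabilityMeasure (armLaw P x a) := by
  unfold armLaw; infer_instance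

lemma measurable_armScore (a : Bool) : Measurable fun x => armScore P x a :=
  (Kernel.measurable_coe _ (measurableSet_singleton a)).ennreal_toReal

lemma armScore_nonneg (x : 𝒳) (a : Bool) : 0 ≤ armScore P x a := measureReal_nonneg

lemma armScore_add_armScore_not (x : 𝒳) (a : Bool) :
    armScore P x a + armScore P x (!a) = 1 := by
  unfold armScore
  rw [← measureReal_union (by simp) (measurableSet_singleton _)]
  convert probReal_univ
  · ext b; cases a <;> cases b <;> simp
  · infer_instance

lemma map_covariate_treatment_eq_compProd :
    (P : Measure (ObsData 𝒳)).map (fun z => (z.1, z.2.2)) = covariateLaw P ⊗ₘ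
      condDistrib (fun z => z.2.2) (fun z => z.1) (P : Measure (ObsData 𝒳)) :=
  (compProd_map_condDistrib (by fun_prop)).symm

/-- The law of `(A, Y)` given `X`, with `A` drawn before `Y`. -/
def treatmentOutcomeKernel : Kernel 𝒳 (Bool × ℝ) :=
  condDistrib (fun z => z.2.2) (fun z => z.1) (P : Measure (ObsData 𝒳)) ⊗ₖ
    condDistrib (fun z => z.2.1) (fun z => (z.1, z.2.2)) (P : Measure (ObsData 𝒳))

instance isMarkovKernel_treatmentOutcomeKernel : IsMarkovKernel (treatmentOutcomeKernel P) := by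
  unfold treatmentOutcomeKernel; infer_instance

lemma lintegral_treatmentOutcomeKernel (x : 𝒳) {f : Bool × ℝ → ENNReal} (hf : Measurable f) :
    ∫⁻ v, f v ∂(treatmentOutcomeKernel P x)
      = ∑ b, ENNReal.ofReal (armScore P x b) * ∫⁻ y, f (b, y) ∂(armLaw P x b) := by
  unfold treatmentOutcomeKernel
  rw [Kernel.lintegral_compProd _ _ _ hf, lintegral_fintype]
  refine Finset.sum_congr rfl fun b _ => ?_
  rw [mul_comm]
  unfold armScore armLaw
  rw [ofReal_measureReal]

lemma coe_eq_compProd_outcomeArmKernel :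
    (P : Measure (ObsData 𝒳))
      = covariateLaw P ⊗ₘ (treatmentOutcomeKernel P).map Prod.swap := by
  have h1 : (P : Measure (ObsData 𝒳)).map (fun z => ((z.1, z.2.2), z.2.1))
      = (covariateLaw P ⊗ₘ condDistrib (fun z => z.2.2) (fun z => z.1) (P : Measure (ObsData 𝒳)))
        ⊗ₘ condDistrib (fun z => z.2.1) (fun z => (z.1, z.2.2)) (P : Measure (ObsData 𝒳)) := by
    rw [← map_covariate_treatment_eq_compProd, compProd_map_condDistrib (by fun_prop)]
  have h2 : (P : Measure (ObsData 𝒳))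
      = ((P : Measure (ObsData 𝒳)).map (fun z => ((z.1, z.2.2), z.2.1))).map
        (fun z => (z.1.1, z.2, z.1.2)) := by
    rw [Measure.map_map (by fun_prop) (by fun_prop)]
    exact Measure.map_id.symm
  rw [h2, h1]
  refine Measure.ext_of_lintegral _ fun f hf => ?_
  rw [lintegral_map hf (by fun_prop), Measure.lintegral_compProd (by fun_prop),
    Measure.lintegral_compProd (by fun_prop), Measure.lintegral_compProd hf]
  refine lintegral_congr fun x => ?_
  rw [Kernel.lintegral_map _ measurable_swap _ (by fun_prop)]
  unfold treatmentOutcomeKernel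
  rw [Kernel.lintegral_compProd _ _ _ (by fun_prop)]
  rfl

/-- The law of `(X, Y, A)`, with `X`, `A` and `Y` drawn in this order. -/
lemma lintegral_obsData {f : ObsData 𝒳 → ENNReal} (hf : Measurable f) :
    ∫⁻ z, f z ∂(P : Measure (ObsData 𝒳)) = ∫⁻ x, ∑ b, ENNReal.ofReal (armScore P x b)
      * ∫⁻ y, f (x, y, b) ∂(armLaw P x b) ∂(covariateLaw P) := by
  conv_lhs => rw [coe_eq_compProd_outcomeArmKernel P]
  rw [Measure.lintegral_compProd hf]
  refine lintegral_congr fun x => ?_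
  rw [Kernel.lintegral_map _ measurable_swap _ (by fun_prop),
    lintegral_treatmentOutcomeKernel P x (by fun_prop)]
  rfl

lemma ae_outcomeArmLaw_eq :
    ∀ᵐ x ∂(covariateLaw P), outcomeArmLaw P x = (treatmentOutcomeKernel P x).map Prod.swap := by
  have h : condDistrib (fun z => z.2) (fun z => z.1) (P : Measure (ObsData 𝒳))
      =ᵐ[covariateLaw P] (treatmentOutcomeKernel P).map Prod.swap := by
    refine condDistrib_ae_eq_of_measure_eq_compProd _ (by fun_prop) ?_
    exact Measure.map_id.trans (coe_eq_compProd_outcomeArmKernel P)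
  filter_upwards [h] with x hx
  rw [← Kernel.map_apply _ measurable_swap]
  exact hx

/-- The exceptional null set does not depend on `f`, so the formula determines the measure at almost
every `x`. -/
lemma ae_lintegral_outcomeArmLaw_eq : ∀ᵐ x ∂(covariateLaw P), ∀ f : ℝ × Bool → ENNReal,
    Measurable f → ∫⁻ v, f v ∂(outcomeArmLaw P x)
      = ∑ b, ENNReal.ofReal (armScore P x b) * ∫⁻ y, f (y, b) ∂(armLaw P x b) := by
  filter_upwards [ae_outcomeArmLaw_eq P] with x hx f hf
  rw [hx, lintegral_map hf measurable_swap, lintegral_treatmentOutcomeKernel P x (by fun_prop)]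
  rfl

lemma ae_outcomeArmLaw_eq_sum : ∀ᵐ x ∂(covariateLaw P), outcomeArmLaw P x
    = ∑ b, ENNReal.ofReal (armScore P x b) • (armLaw P x b).map (fun y => (y, b)) := by
  filter_upwards [ae_lintegral_outcomeArmLaw_eq P] with x hx
  refine Measure.ext_of_lintegral _ fun f hf => ?_
  rw [hx f hf, lintegral_finsetSum_measure]
  refine Finset.sum_congr rfl fun b _ => ?_
  rw [lintegral_smul_measure, lintegral_map hf (by fun_prop), smul_eq_mul]

lemma ae_outcomeLaw_eq_sum : ∀ᵐ x ∂(covariateLaw P), outcomeLaw P x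
    = ∑ b, ENNReal.ofReal (armScore P x b) • armLaw P x b := by
  have h : condDistrib (fun z => z.2.1) (fun z => z.1) (P : Measure (ObsData 𝒳))
      =ᵐ[covariateLaw P]
        (condDistrib (fun z => z.2) (fun z => z.1) (P : Measure (ObsData 𝒳))).map Prod.fst :=
    condDistrib_comp (f := Prod.fst) _ (by fun_prop) measurable_fst
  filter_upwards [h, ae_lintegral_outcomeArmLaw_eq P] with x hx hx'
  have hx'' : outcomeLaw P x = (outcomeArmLaw P x).map Prod.fst := by
    unfold outcomeLaw
    rw [hx, Kernel.map_apply _ measurable_fst]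
    rfl
  refine Measure.ext_of_lintegral _ fun f hf => ?_
  rw [hx'', lintegral_map hf measurable_fst, hx' _ (by fun_prop), lintegral_finsetSum_measure]
  refine Finset.sum_congr rfl fun b _ => ?_
  rw [lintegral_smul_measure, smul_eq_mul]

/-- The law of `Y` given `X` is a mixture of the two arms, so it dominates a positive multiple of
each arm that has positive probability. -/
lemma ae_integrable_armLaw
    (hY : ∀ᵐ x ∂(covariateLaw P), Integrable (fun y : ℝ => y) (outcomeLaw P x)) (a : Bool)
    (hpos : ∀ᵐ x ∂(covariateLaw P), 0 < armScore P x a) :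
    ∀ᵐ x ∂(covariateLaw P), Integrable (fun y : ℝ => y) (armLaw P x a) := by
  filter_upwards [hY, hpos, ae_outcomeLaw_eq_sum P] with x hx h0 heq
  have hle : ENNReal.ofReal (armScore P x a) • armLaw P x a ≤ outcomeLaw P x := by
    rw [heq]
    exact Finset.single_le_sum (f := fun b => ENNReal.ofReal (armScore P x b) • armLaw P x b)
      (fun _ _ => Measure.zero_le _) (Finset.mem_univ a)
  exact (integrable_smul_measure (by simpa using h0) ENNReal.ofReal_ne_top).1 (hx.mono_measure hle)

end Disintegration

/-! ### Observed law of a full-data law, and positivity -/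

section Observed

variable {𝒳 : Type*} [MeasurableSpace 𝒳] {k : ℕ} (Q : ProbabilityMeasure (FullData 𝒳 k))

lemma coe_observedLaw : (observedLaw Q : Measure (ObsData 𝒳)) =
    (Q : Measure (FullData 𝒳 k)).map observe := rfl

lemma measurable_covariate : Measurable (covariate : FullData 𝒳 k → 𝒳) := measurable_fst

lemma measurable_treatment : Measurable (treatment : FullData 𝒳 k → Bool) := by
  unfold treatment; fun_prop

lemma measurable_potential : Measurable (potential : FullData 𝒳 k → Bool → ℝ) := by
  unfold potential; fun_prop

lemma covariateLaw_observedLaw :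
    covariateLaw (observedLaw Q) = (Q : Measure (FullData 𝒳 k)).map covariate := by
  unfold covariateLaw
  rw [coe_observedLaw, Measure.map_map measurable_fst measurable_observe]
  rfl

/-- Valid at every `x`: `condDistrib` is built from the joint law alone, and the joint laws of `(X,
A)` coincide. -/
lemma nominalScore_eq_armScore (x : 𝒳) :
    nominalScore Q x = armScore (observedLaw Q) x true := by
  have h : (observedLaw Q : Measure (ObsData 𝒳)).map (fun z => (z.1, z.2.2))
      = (Q : Measure (FullData 𝒳 k)).map (fun o => (covariate o, treatment o)) := by
    rw [coe_observedLaw, Measure.map_map (by fun_prop) measurable_observe]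
    rfl
  unfold nominalScore armScore
  rw [condDistrib, condDistrib]
  simp only [h]

/-- A nominal score equal to `0` or `1` would make the odds ratio `0` by the division convention,
against the lower bound `1 / Λ > 0`. -/
lemma MSM.ae_armScore_pos [StandardBorelSpace 𝒳] {Λ : ℝ} (hΛ : 1 ≤ Λ) {Q} (hQ : MSM (k := k) Λ Q) :
    ∀ᵐ x ∂(covariateLaw (observedLaw Q) : Measure 𝒳), ∀ a, 0 < armScore (observedLaw Q) x a := by
  rw [covariateLaw_observedLaw, ae_map_iff measurable_covariate.aemeasurable]
  · filter_upwards [hQ.odds_ratio] with o ho a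
    have hpos : 0 < 1 / Λ := by positivity
    have hlow := hpos.trans_le ho.1
    have h0 : nominalScore Q (covariate o) ≠ 0 := fun h => by simp [h] at hlow
    have h1 : 1 - nominalScore Q (covariate o) ≠ 0 := fun h => by simp [h] at hlow
    rw [nominalScore_eq_armScore] at h0 h1
    have hadd := armScore_add_armScore_not (observedLaw Q) (covariate o) true
    refine lt_of_le_of_ne (armScore_nonneg _ _ _) (Ne.symm ?_)
    cases a
    · rw [← hadd] at h1
      simpa using h1
    · exact h0
  · have : {x | ∀ a, 0 < armScore (observedLaw Q) x a}
        = ⋂ a, {x | 0 < armScore (observedLaw Q) x a} := by ext; simp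
    rw [this]
    exact MeasurableSet.iInter fun a => measurableSet_lt measurable_const (measurable_armScore _ a)

end Observed

/-! ### Conditional law of a potential outcome -/

section PotentialLaw

variable {𝒳 : Type*} [MeasurableSpace 𝒳] {k : ℕ}

lemma compProd_withDensity_eq_withDensity_compProd {ν : Measure 𝒳} [SFinite ν] {κ : Kernel 𝒳 ℝ}
    [IsFiniteKernel κ] {f : 𝒳 × ℝ → ENNReal} (hf : Measurable f)
    [IsFiniteKernel (κ.withDensity fun x y => f (x, y))] :
    ν ⊗ₘ (κ.withDensity fun x y => f (x, y)) = (ν ⊗ₘ κ).withDensity f := by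
  refine Measure.ext_of_lintegral _ fun h hh => ?_
  rw [Measure.lintegral_compProd hh, lintegral_withDensity_eq_lintegral_mul _ hf hh,
    Measure.lintegral_compProd (hf.mul hh)]
  refine lintegral_congr fun x => ?_
  exact Kernel.lintegral_withDensity _ (by exact hf) x (by fun_prop)

/-- The conditional law of `Y(a)` given `X`, read off from the joint law of `(X, Y(a))`. -/
lemma ae_potentialLaw_eq_withDensity {Q : ProbabilityMeasure (FullData 𝒳 k)} {κ : Kernel 𝒳 ℝ}
    [IsFiniteKernel κ] {a : Bool} {g : 𝒳 × ℝ → ℝ} (hg : Measurable g) {B : ℝ}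
    (hB : ∀ z, g z ≤ B)
    (h : (Q : Measure (FullData 𝒳 k)).map (fun o => (covariate o, potential o a))
      = (((Q : Measure (FullData 𝒳 k)).map covariate) ⊗ₘ κ).withDensity
        fun z => ENNReal.ofReal (g z)) :
    ∀ᵐ x ∂((Q : Measure (FullData 𝒳 k)).map covariate),
      potentialLaw Q x a = (κ x).withDensity fun y => ENNReal.ofReal (g (x, y)) := by
  have hf : Measurable fun z => ENNReal.ofReal (g z) := hg.ennreal_ofReal
  have : IsFiniteKernel (κ.withDensity fun x y => ENNReal.ofReal (g (x, y))) :=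
    Kernel.isFiniteKernel_withDensity_of_bounded κ (B := ENNReal.ofReal B) ENNReal.ofReal_ne_top
      fun x y => ENNReal.ofReal_le_ofReal (hB _)
  have hm : Measurable fun o : FullData 𝒳 k => potential o a := by
    unfold potential; fun_prop
  rw [← compProd_withDensity_eq_withDensity_compProd hf] at h
  filter_upwards [condDistrib_ae_eq_of_measure_eq_compProd covariate hm.aemeasurable h] with x hx
  unfold potentialLaw
  rw [hx, Kernel.withDensity_apply _ (by exact hf)]

lemma trueScore_mem_Icc (Q : ProbabilityMeasure (FullData 𝒳 k)) (z : 𝒳 × (Fin k → ℝ)) :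
    trueScore Q z ∈ Set.Icc 0 1 := ⟨measureReal_nonneg, measureReal_le_one⟩

lemma condDistrib_treatment_real_false (Q : ProbabilityMeasure (FullData 𝒳 k))
    (z : 𝒳 × (Fin k → ℝ)) :
    (condDistrib treatment confounders (Q : Measure (FullData 𝒳 k)) z).real {false}
      = 1 - trueScore Q z := by
  unfold trueScore
  rw [← probReal_compl_eq_one_sub (measurableSet_singleton _)]
  congr 1
  ext b; cases b <;> simp

lemma measurable_ofReal_mixedScore (P : ProbabilityMeasure (ObsData 𝒳)) (a : Bool) (c : ℝ) :
    Measurable fun z : 𝒳 × ℝ =>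
      ENNReal.ofReal (armScore P z.1 a + c * armScore P z.1 (!a)) :=
  (((measurable_armScore P a).add ((measurable_armScore P (!a)).const_mul c)).comp
    measurable_fst).ennreal_ofReal

lemma condDistrib_treatment_real_add (Q : ProbabilityMeasure (FullData 𝒳 k))
    (z : 𝒳 × (Fin k → ℝ)) (a : Bool) :
    (condDistrib treatment confounders (Q : Measure (FullData 𝒳 k)) z).real {a}
      + (condDistrib treatment confounders (Q : Measure (FullData 𝒳 k)) z).real {!a} = 1 := by
  rw [← measureReal_union (by simp) (measurableSet_singleton _)]
  convert probReal_univ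
  · ext b; cases a <;> cases b <;> simp
  · infer_instance

/-- Factoring `e + c e' = (1 + c e' / e) e` exposes the weight `e` of the observed arm, which is
what latent unconfoundedness can translate into an integral over `(X, U)`. -/
lemma lintegral_withDensity_mixedScore (P : ProbabilityMeasure (ObsData 𝒳)) (a : Bool) {c : ℝ}
    (hc : 0 ≤ c) (hpos : ∀ᵐ x ∂(covariateLaw P), 0 < armScore P x a)
    {f : 𝒳 × ℝ → ENNReal} (hf : Measurable f) :
    ∫⁻ z, f z ∂((covariateLaw P ⊗ₘ armKernel P a).withDensity fun z =>
        ENNReal.ofReal (armScore P z.1 a + c * armScore P z.1 (!a)))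
      = ∫⁻ x, ENNReal.ofReal (1 + c * armScore P x (!a) / armScore P x a)
          * ENNReal.ofReal (armScore P x a) * ∫⁻ y, f (x, y) ∂(armLaw P x a)
        ∂(covariateLaw P) := by
  have hm := measurable_ofReal_mixedScore P a c
  rw [lintegral_withDensity_eq_lintegral_mul _ hm hf, Measure.lintegral_compProd (hm.mul hf)]
  refine lintegral_congr_ae ?_
  filter_upwards [hpos] with x hx
  have h0 := armScore_nonneg P x (!a)
  rw [← ENNReal.ofReal_mul (by positivity), ← lintegral_const_mul _ (by fun_prop), add_mul,
    div_mul_cancel₀ _ hx.ne', one_mul]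
  rfl

end PotentialLaw

/-! ### Density bounds forced by the sensitivity model -/

section Necessity

variable {𝒳 : Type*} [MeasurableSpace 𝒳] [StandardBorelSpace 𝒳] {k : ℕ}
  {Q : ProbabilityMeasure (FullData 𝒳 k)} {Λ : ℝ}

lemma LatentUnconfounded.lintegral_eq (hQ : LatentUnconfounded Q)
    {f : (𝒳 × (Fin k → ℝ)) × (Bool → ℝ) × Bool → ENNReal} (hf : Measurable f) :
    ∫⁻ o, f (confounders o, potential o, treatment o) ∂(Q : Measure (FullData 𝒳 k))
      = ∫⁻ z, ∫⁻ y, ∑ b, f (z, y, b)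
            * condDistrib treatment confounders (Q : Measure (FullData 𝒳 k)) z {b}
          ∂(condDistrib potential confounders (Q : Measure (FullData 𝒳 k)) z)
        ∂((Q : Measure (FullData 𝒳 k)).map confounders) := by
  have h := (condIndepFun_iff_map_prod_eq_prod_condDistrib_prod_condDistrib
    measurable_potential measurable_treatment measurable_confounders).1 hQ
  rw [← Measure.compProd_eq_comp_prod] at h
  rw [← lintegral_map (f := f) hf (g := fun o => (confounders o, potential o, treatment o))
    (measurable_confounders.prodMk (measurable_potential.prodMk measurable_treatment)), h,
    Measure.lintegral_compProd hf]
  refine lintegral_congr fun z => ?_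
  rw [Kernel.lintegral_prod _ _ _ (by fun_prop)]
  refine lintegral_congr fun y => ?_
  rw [lintegral_fintype]

lemma odds_bounds {t n : ℝ} (hΛ : 1 ≤ Λ) (ht : t ∈ Set.Icc (0 : ℝ) 1) (hn : n ∈ Set.Icc (0 : ℝ) 1)
    (h : 1 / Λ ≤ (t / (1 - t)) / (n / (1 - n)) ∧ (t / (1 - t)) / (n / (1 - n)) ≤ Λ) :
    (1 - t) * n ≤ Λ * ((1 - n) * t) ∧ t * (1 - n) ≤ Λ * (n * (1 - t)) := by
  have hΛ0 : 0 < Λ := by linarith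
  have hlow := (show 0 < 1 / Λ by positivity).trans_le h.1
  have h1 : t ≠ 0 := fun h => by simp [h] at hlow
  have h2 : 1 - t ≠ 0 := fun h => by simp [h] at hlow
  have h3 : n ≠ 0 := fun h => by simp [h] at hlow
  have h4 : 1 - n ≠ 0 := fun h => by simp [h] at hlow
  have h1 : 0 < t := lt_of_le_of_ne ht.1 (Ne.symm h1)
  have h2 : 0 < 1 - t := lt_of_le_of_ne (by linarith [ht.2]) (Ne.symm h2)
  have h3 : 0 < n := lt_of_le_of_ne hn.1 (Ne.symm h3)
  have h4 : 0 < 1 - n := lt_of_le_of_ne (by linarith [hn.2]) (Ne.symm h4)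
  rw [div_div_div_eq, div_le_div_iff₀ hΛ0 (by positivity), div_le_iff₀ (by positivity)] at h
  constructor <;> linarith [h.1, h.2]

/-- One inequality, symmetric in the arms, encodes both odds bounds: arm `a` will give the upper
density bound for `Y(a)`, and arm `!a` the lower one. -/
lemma MSM.ae_treatment_odds_le (hΛ : 1 ≤ Λ) (hQ : MSM Λ Q) (a : Bool) :
    ∀ᵐ z ∂((Q : Measure (FullData 𝒳 k)).map confounders),
      (condDistrib treatment confounders (Q : Measure (FullData 𝒳 k)) z).real {!a}
          * armScore (observedLaw Q) z.1 a
        ≤ Λ * (armScore (observedLaw Q) z.1 (!a)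
          * (condDistrib treatment confounders (Q : Measure (FullData 𝒳 k)) z).real {a}) := by
  have hm (b : Bool) : Measurable fun z =>
      (condDistrib treatment confounders (Q : Measure (FullData 𝒳 k)) z).real {b} :=
    (Kernel.measurable_coe _ (measurableSet_singleton b)).ennreal_toReal
  have hs (b : Bool) : Measurable fun z : 𝒳 × (Fin k → ℝ) => armScore (observedLaw Q) z.1 b :=
    (measurable_armScore _ b).comp measurable_fst
  refine (ae_map_iff measurable_confounders.aemeasurable
    (measurableSet_le ((hm _).mul (hs _)) (((hs _).mul (hm _)).const_mul _))).2 ?_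
  filter_upwards [hQ.odds_ratio] with o ho
  have hadd := armScore_add_armScore_not (observedLaw Q) (covariate o) true
  have hn : nominalScore Q (covariate o) ∈ Set.Icc (0 : ℝ) 1 :=
    ⟨measureReal_nonneg, measureReal_le_one⟩
  have hf : armScore (observedLaw Q) (covariate o) false = 1 - nominalScore Q (covariate o) := by
    rw [nominalScore_eq_armScore, ← hadd]; simp
  obtain ⟨h1, h2⟩ := odds_bounds hΛ (trueScore_mem_Icc Q (confounders o)) hn ho
  change (condDistrib treatment confounders (Q : Measure (FullData 𝒳 k)) (confounders o)).real {!a}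
      * armScore (observedLaw Q) (covariate o) a
    ≤ Λ * (armScore (observedLaw Q) (covariate o) (!a)
      * (condDistrib treatment confounders (Q : Measure (FullData 𝒳 k)) (confounders o)).real {a})
  cases a
  · rw [Bool.not_false, condDistrib_treatment_real_false, hf, ← nominalScore_eq_armScore]
    exact h2
  · rw [Bool.not_true, condDistrib_treatment_real_false, hf, ← nominalScore_eq_armScore]
    exact h1

/-- The part of the law of `(X, Y(a))` on `{A = a}` is identified by the observed data. -/
lemma LatentUnconfounded.lintegral_arm (hQ : LatentUnconfounded Q) (a : Bool)
    {H : 𝒳 → ENNReal} (hH : Measurable H) {f : 𝒳 × ℝ → ENNReal} (hf : Measurable f) :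
    ∫⁻ z, H z.1 * condDistrib treatment confounders (Q : Measure (FullData 𝒳 k)) z {a}
          * ∫⁻ y, f (z.1, y a) ∂(condDistrib potential confounders (Q : Measure (FullData 𝒳 k)) z)
        ∂((Q : Measure (FullData 𝒳 k)).map confounders)
      = ∫⁻ x, H x * ENNReal.ofReal (armScore (observedLaw Q) x a)
          * ∫⁻ y, f (x, y) ∂(armLaw (observedLaw Q) x a) ∂(covariateLaw (observedLaw Q)) := by
  have h1 := hQ.lintegral_eq
    (f := fun v => H v.1.1 * f (v.1.1, v.2.1 a) * if v.2.2 = a then 1 else 0)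
    (((hH.comp (by fun_prop)).mul (hf.comp (by fun_prop))).mul
      (Measurable.ite (measurableSet_eq_fun (by fun_prop) measurable_const)
        measurable_const measurable_const))
  have hfm : Measurable fun v : ObsData 𝒳 => H v.1 * f (v.1, v.2.1) * if v.2.2 = a then 1 else 0 :=
    (((hH.comp (by fun_prop)).mul (hf.comp (by fun_prop))).mul
      (Measurable.ite (measurableSet_eq_fun (by fun_prop) measurable_const)
        measurable_const measurable_const))
  have h2 := lintegral_obsData (observedLaw Q) hfm
  rw [coe_observedLaw, lintegral_map hfm measurable_observe] at h2
  -- On `{A = a}` the potential outcome `Y(a)` is the observed outcome; elsewhere the indicator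
  -- removes both sides.
  have h3 : ∀ o : FullData 𝒳 k,
      (H (confounders o).1 * f ((confounders o).1, potential o a)
        * if treatment o = a then (1 : ENNReal) else 0)
      = H (observe o).1 * f ((observe o).1, (observe o).2.1)
        * if (observe o).2.2 = a then (1 : ENNReal) else 0 := by
    intro o
    by_cases h : treatment o = a
    · subst h; rfl
    · have h' : (observe o).2.2 ≠ a := h
      rw [if_neg h, if_neg h', mul_zero, mul_zero]
  simp_rw [h3] at h1
  rw [h1] at h2
  convert h2 using 1
  · refine lintegral_congr fun z => ?_
    rw [← lintegral_const_mul _ (by fun_prop)]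
    refine lintegral_congr fun y => ?_
    cases a <;> simp <;> ring
  · refine lintegral_congr fun x => ?_
    have h4 : ∀ b : Bool, ∫⁻ y, H x * f (x, y) * (if b = a then 1 else 0)
        ∂(armLaw (observedLaw Q) x b)
        = if b = a then H x * ∫⁻ y, f (x, y) ∂(armLaw (observedLaw Q) x b) else 0 := by
      intro b
      split_ifs
      · simp_rw [mul_one]
        exact lintegral_const_mul _ (by fun_prop)
      · simp
    simp_rw [h4]
    cases a <;> simp <;> ring

lemma LatentUnconfounded.lintegral_covariate_potential (hQ : LatentUnconfounded Q) (a : Bool)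
    {f : 𝒳 × ℝ → ENNReal} (hf : Measurable f) :
    ∫⁻ z, f z ∂((Q : Measure (FullData 𝒳 k)).map fun o => (covariate o, potential o a))
      = ∫⁻ z, ∫⁻ y, f (z.1, y a)
          ∂(condDistrib potential confounders (Q : Measure (FullData 𝒳 k)) z)
        ∂((Q : Measure (FullData 𝒳 k)).map confounders) := by
  have hm : Measurable fun o : FullData 𝒳 k => (covariate o, potential o a) :=
    measurable_covariate.prodMk ((measurable_pi_apply a).comp measurable_potential)
  rw [lintegral_map hf hm]
  have h1 := hQ.lintegral_eq (f := fun v => f (v.1.1, v.2.1 a)) (by fun_prop)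
  refine Eq.trans h1 (lintegral_congr fun z => lintegral_congr fun y => ?_)
  change ∑ b, f (z.1, y a) * _ = f (z.1, y a)
  rw [← Finset.mul_sum, sum_measure_singleton, Finset.coe_univ, measure_univ, mul_one]

lemma MSM.ae_confounders_armScore_pos (hΛ : 1 ≤ Λ) (hQ : MSM Λ Q) (a : Bool) :
    ∀ᵐ z ∂((Q : Measure (FullData 𝒳 k)).map confounders),
      0 < armScore (observedLaw Q) z.1 a := by
  have hpos := (hQ.ae_armScore_pos hΛ).mono fun x hx => hx a
  have h : (Q : Measure (FullData 𝒳 k)).map covariate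
      = ((Q : Measure (FullData 𝒳 k)).map confounders).map Prod.fst := by
    rw [Measure.map_map measurable_fst measurable_confounders]; rfl
  rw [covariateLaw_observedLaw, h] at hpos
  exact ae_of_ae_map measurable_fst.aemeasurable hpos

/-- Written over `(X, U)`, this measure differs from the law of `(X, Y(a))` only by the factor `(1 +
c e' / e) π`. Comparing the two measures thus reduces to comparing that factor with `1`. -/
lemma MSM.withDensity_mixedScore_apply (hΛ : 1 ≤ Λ) (hQ : MSM Λ Q) (a : Bool) {c : ℝ}
    (hc : 0 ≤ c) {s : Set (𝒳 × ℝ)} (hs : MeasurableSet s) :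
    (covariateLaw (observedLaw Q) ⊗ₘ armKernel (observedLaw Q) a).withDensity (fun z =>
        ENNReal.ofReal (armScore (observedLaw Q) z.1 a
          + c * armScore (observedLaw Q) z.1 (!a))) s
      = ∫⁻ z, ENNReal.ofReal ((1 + c * armScore (observedLaw Q) z.1 (!a)
              / armScore (observedLaw Q) z.1 a)
            * (condDistrib treatment confounders (Q : Measure (FullData 𝒳 k)) z).real {a})
          * ∫⁻ y, s.indicator 1 (z.1, y a)
            ∂(condDistrib potential confounders (Q : Measure (FullData 𝒳 k)) z)
        ∂((Q : Measure (FullData 𝒳 k)).map confounders) := by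
  have hH : Measurable fun x => ENNReal.ofReal
      (1 + c * armScore (observedLaw Q) x (!a) / armScore (observedLaw Q) x a) :=
    (measurable_const.add (((measurable_armScore _ _).const_mul _).div
      (measurable_armScore _ _))).ennreal_ofReal
  have hi : Measurable (s.indicator (1 : 𝒳 × ℝ → ENNReal)) := measurable_one.indicator hs
  rw [← lintegral_indicator_one hs, lintegral_withDensity_mixedScore _ a hc
    ((hQ.ae_armScore_pos hΛ).mono fun x hx => hx a) hi,
    ← hQ.latent_unconfounded.lintegral_arm a hH hi]
  refine lintegral_congr fun z => ?_
  have h0 := armScore_nonneg (observedLaw Q) z.1 (!a)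
  have h1 := armScore_nonneg (observedLaw Q) z.1 a
  rw [ENNReal.ofReal_mul (by positivity), ofReal_measureReal]

/-- The law of `(X, Y(a))` is bounded by a multiple of the law of `(X, Y)` with `Y` drawn from
the observed arm `a`. -/
lemma MSM.map_covariate_potential_le (hΛ : 1 ≤ Λ) (hQ : MSM Λ Q) (a : Bool) :
    (Q : Measure (FullData 𝒳 k)).map (fun o => (covariate o, potential o a))
      ≤ (covariateLaw (observedLaw Q) ⊗ₘ armKernel (observedLaw Q) a).withDensity fun z =>
        ENNReal.ofReal (armScore (observedLaw Q) z.1 a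
          + Λ * armScore (observedLaw Q) z.1 (!a)) := by
  refine Measure.le_iff.2 fun s hs => ?_
  rw [hQ.withDensity_mixedScore_apply hΛ a (by linarith) hs, ← lintegral_indicator_one hs,
    hQ.latent_unconfounded.lintegral_covariate_potential a (measurable_one.indicator hs)]
  refine lintegral_mono_ae ?_
  filter_upwards [hQ.ae_confounders_armScore_pos hΛ a, hQ.ae_treatment_odds_le hΛ a]
    with z hz hodds
  -- It remains to see `1 ≤ (1 + Λ e' / e) π`; with `1 = π + (1 - π)` this is the odds inequality
  -- for arm `a`.
  refine le_mul_of_one_le_left zero_le ?_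
  rw [ENNReal.one_le_ofReal, add_mul, one_mul, ← condDistrib_treatment_real_add Q z a,
    add_le_add_iff_left, div_mul_eq_mul_div, le_div_iff₀ hz]
  linarith

/-- The law of `(X, Y(a))` is bounded below by a multiple of the law of `(X, Y)` with `Y` drawn
from the observed arm `a`. -/
lemma MSM.le_map_covariate_potential (hΛ : 1 ≤ Λ) (hQ : MSM Λ Q) (a : Bool) :
    (covariateLaw (observedLaw Q) ⊗ₘ armKernel (observedLaw Q) a).withDensity (fun z =>
        ENNReal.ofReal (armScore (observedLaw Q) z.1 a
          + 1 / Λ * armScore (observedLaw Q) z.1 (!a)))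
      ≤ (Q : Measure (FullData 𝒳 k)).map (fun o => (covariate o, potential o a)) := by
  have hΛ0 : 0 < Λ := by linarith
  refine Measure.le_iff.2 fun s hs => ?_
  rw [hQ.withDensity_mixedScore_apply hΛ a (by positivity) hs, ← lintegral_indicator_one hs,
    hQ.latent_unconfounded.lintegral_covariate_potential a (measurable_one.indicator hs)]
  refine lintegral_mono_ae ?_
  filter_upwards [hQ.ae_confounders_armScore_pos hΛ a, hQ.ae_treatment_odds_le hΛ (!a)]
    with z hz hodds
  -- Likewise `(1 + e' / (Λ e)) π ≤ 1` is the odds inequality for the other arm.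
  refine mul_le_of_le_one_left zero_le ?_
  rw [Bool.not_not] at hodds
  have hsum := condDistrib_treatment_real_add Q z a
  rw [ENNReal.ofReal_le_one, add_mul, one_mul, ← hsum, add_le_add_iff_left, div_mul_eq_mul_div,
    div_le_iff₀ hz, hsum, one_div, mul_assoc, inv_mul_le_iff₀ hΛ0]
  linarith

theorem exists_density_mem_Icc {Ω : Type*} [MeasurableSpace Ω] {m R : Measure Ω}
    [IsFiniteMeasure m] [IsFiniteMeasure R] {l u : Ω → ℝ} (hl : Measurable l) (hu : Measurable u)
    (hl0 : ∀ z, 0 ≤ l z) (hlu : ∀ z, l z ≤ u z)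
    (h_up : m ≤ R.withDensity fun z => ENNReal.ofReal (u z))
    (h_lo : (R.withDensity fun z => ENNReal.ofReal (l z)) ≤ m) :
    ∃ g : Ω → ℝ, Measurable g ∧ (∀ z, g z ∈ Set.Icc (l z) (u z)) ∧
      m = R.withDensity fun z => ENNReal.ofReal (g z) := by
  have hac : m ≪ R := (Measure.absolutelyContinuous_of_le h_up).trans
    (withDensity_absolutelyContinuous _ _)
  have hden : R.withDensity (m.rnDeriv R) = m := Measure.withDensity_rnDeriv_eq _ _ hac
  have h1 : m.rnDeriv R ≤ᵐ[R] fun z => ENNReal.ofReal (u z) := by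
    refine ae_le_of_forall_setLIntegral_le_of_sigmaFinite (Measure.measurable_rnDeriv _ _) ?_
    intro s hs _
    rw [← withDensity_apply _ hs, ← withDensity_apply _ hs, hden]
    exact h_up s
  have h2 : (fun z => ENNReal.ofReal (l z)) ≤ᵐ[R] m.rnDeriv R := by
    refine ae_le_of_forall_setLIntegral_le_of_sigmaFinite hl.ennreal_ofReal ?_
    intro s hs _
    rw [← withDensity_apply _ hs, ← withDensity_apply _ hs, hden]
    exact h_lo s
  -- The Radon-Nikodym derivative satisfies the bounds only almost everywhere; clamping it makes
  -- them hold at every point without changing the measure.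
  refine ⟨fun z => max (l z) (min (u z) ((m.rnDeriv R z).toReal)),
    hl.max (hu.min (Measure.measurable_rnDeriv _ _).ennreal_toReal),
    fun z => ⟨le_max_left _ _, max_le (hlu z) (min_le_left _ _)⟩, ?_⟩
  refine hden.symm.trans (withDensity_congr_ae ?_)
  filter_upwards [h1, h2] with z hz1 hz2
  have hz : m.rnDeriv R z ≠ ⊤ := ne_top_of_le_ne_top ENNReal.ofReal_ne_top hz1
  have hz1' : (m.rnDeriv R z).toReal ≤ u z :=
    ENNReal.toReal_le_of_le_ofReal ((hl0 z).trans (hlu z)) hz1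
  have hz2' : l z ≤ (m.rnDeriv R z).toReal := (ENNReal.ofReal_le_iff_le_toReal hz).1 hz2
  rw [min_eq_right hz1', max_eq_right hz2', ENNReal.ofReal_toReal hz]

/-- Under the marginal sensitivity model the conditional law of `Y(a)` given `X` has a density,
with explicit bounds, with respect to the conditional law of `Y` given `X` and `A = a`. -/
theorem MSM.exists_density (hΛ : 1 ≤ Λ) (hQ : MSM Λ Q) (a : Bool) :
    ∃ g : 𝒳 × ℝ → ℝ, Measurable g ∧
      (∀ z, g z ∈ Set.Icc
        (armScore (observedLaw Q) z.1 a + 1 / Λ * armScore (observedLaw Q) z.1 (!a))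
        (armScore (observedLaw Q) z.1 a + Λ * armScore (observedLaw Q) z.1 (!a))) ∧
      ∀ᵐ x ∂(covariateLaw (observedLaw Q)), potentialLaw Q x a
        = (armLaw (observedLaw Q) x a).withDensity fun y => ENNReal.ofReal (g (x, y)) := by
  have hΛ0 : 0 < Λ := by linarith
  have hle : 1 / Λ ≤ Λ := by rw [div_le_iff₀ hΛ0]; nlinarith
  have hm (c : ℝ) : Measurable fun z : 𝒳 × ℝ =>
      armScore (observedLaw Q) z.1 a + c * armScore (observedLaw Q) z.1 (!a) :=
    ((measurable_armScore _ a).add ((measurable_armScore _ (!a)).const_mul c)).comp measurable_fst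
  have h_up := hQ.map_covariate_potential_le hΛ a
  have h_lo := hQ.le_map_covariate_potential hΛ a
  have : IsFiniteMeasure ((Q : Measure (FullData 𝒳 k)).map
      (fun o => (covariate o, potential o a))) := inferInstance
  obtain ⟨g, hg, hmem, heq⟩ := exists_density_mem_Icc (hm (1 / Λ)) (hm Λ)
    (fun z => by
      have h0 := armScore_nonneg (observedLaw Q) z.1 (!a)
      have h1 := armScore_nonneg (observedLaw Q) z.1 a
      positivity)
    (fun z => by
      have h0 := armScore_nonneg (observedLaw Q) z.1 (!a)
      gcongr)
    h_up h_lo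
  refine ⟨g, hg, hmem, ?_⟩
  have hB (z : 𝒳 × ℝ) : g z ≤ 1 + Λ := by
    refine (hmem z).2.trans ?_
    have h0 := armScore_nonneg (observedLaw Q) z.1 (!a)
    have h1 := armScore_nonneg (observedLaw Q) z.1 a
    have h2 := armScore_add_armScore_not (observedLaw Q) z.1 a
    nlinarith
  rw [covariateLaw_observedLaw] at heq ⊢
  exact ae_potentialLaw_eq_withDensity (κ := armKernel (observedLaw Q) a) hg hB heq

end Necessity

/-! ### Full-data laws built from conditionally independent kernels -/

section FullLaw

variable {𝒳 : Type*} [MeasurableSpace 𝒳] {k : ℕ}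
  (ζ : Measure (𝒳 × (Fin k → ℝ))) [IsProbabilityMeasure ζ]
  (κ : Kernel (𝒳 × (Fin k → ℝ)) (Bool → ℝ)) [IsMarkovKernel κ]
  (η : Kernel (𝒳 × (Fin k → ℝ)) Bool) [IsMarkovKernel η]

/-- The law of the full data under which `(X, U)` has law `ζ` and, given `(X, U)`, the potential
outcomes and the treatment are independent with laws `κ` and `η`. -/
def fullLaw : ProbabilityMeasure (FullData 𝒳 k) :=
  ⟨(ζ ⊗ₘ (κ ×ₖ η)).map fun v => (v.1.1, v.2.1, v.2.2, v.1.2),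
    Measure.isProbabilityMeasure_map (by fun_prop)⟩

lemma coe_fullLaw : (fullLaw ζ κ η : Measure (FullData 𝒳 k))
    = (ζ ⊗ₘ (κ ×ₖ η)).map fun v => (v.1.1, v.2.1, v.2.2, v.1.2) := rfl

lemma lintegral_fullLaw {f : FullData 𝒳 k → ENNReal} (hf : Measurable f) :
    ∫⁻ o, f o ∂(fullLaw ζ κ η : Measure (FullData 𝒳 k))
      = ∫⁻ z, ∫⁻ y, ∫⁻ b, f (z.1, y, b, z.2) ∂(η z) ∂(κ z) ∂ζ := by
  rw [coe_fullLaw, lintegral_map hf (by fun_prop), Measure.lintegral_compProd (by fun_prop)]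
  refine lintegral_congr fun z => ?_
  rw [Kernel.lintegral_prod _ _ _ (by fun_prop)]

lemma map_fullLaw : (fullLaw ζ κ η : Measure (FullData 𝒳 k)).map
    (fun o => (confounders o, potential o, treatment o)) = ζ ⊗ₘ (κ ×ₖ η) := by
  rw [coe_fullLaw, Measure.map_map (measurable_confounders.prodMk
    (measurable_potential.prodMk measurable_treatment)) (by fun_prop)]
  exact Measure.map_id

lemma map_confounders_fullLaw :
    (fullLaw ζ κ η : Measure (FullData 𝒳 k)).map confounders = ζ := by
  rw [coe_fullLaw, Measure.map_map measurable_confounders (by fun_prop)]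
  exact Measure.fst_compProd _ _

lemma measurable_lintegral_lintegral {f : FullData 𝒳 k → ENNReal} (hf : Measurable f) :
    Measurable fun z => ∫⁻ y, ∫⁻ b, f (z.1, y, b, z.2) ∂(η z) ∂(κ z) := by
  have h : (fun z => ∫⁻ y, ∫⁻ b, f (z.1, y, b, z.2) ∂(η z) ∂(κ z))
      = fun z => ∫⁻ v, f (z.1, v.1, v.2, z.2) ∂((κ ×ₖ η) z) := by
    funext z
    rw [Kernel.lintegral_prod _ _ _ (by fun_prop)]
  rw [h]
  exact Measurable.lintegral_kernel_prod_right'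
    (f := fun p : (𝒳 × (Fin k → ℝ)) × (Bool → ℝ) × Bool => f (p.1.1, p.2.1, p.2.2, p.1.2))
    (by fun_prop)

lemma condDistrib_potential_fullLaw :
    condDistrib potential confounders (fullLaw ζ κ η : Measure (FullData 𝒳 k)) =ᵐ[ζ] κ := by
  have h : (fullLaw ζ κ η : Measure (FullData 𝒳 k)).map (fun o => (confounders o, potential o))
      = (fullLaw ζ κ η : Measure (FullData 𝒳 k)).map confounders ⊗ₘ κ := by
    rw [map_confounders_fullLaw]
    refine Measure.ext_of_lintegral _ fun f hf => ?_
    have hm := measurable_confounders.prodMk (measurable_potential (𝒳 := 𝒳) (k := k))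
    rw [lintegral_map hf hm, Measure.lintegral_compProd hf]
    refine (lintegral_fullLaw ζ κ η (hf.comp hm)).trans ?_
    refine lintegral_congr fun z => lintegral_congr fun y => ?_
    change ∫⁻ _, f (z, y) ∂(η z) = f (z, y)
    rw [lintegral_const, measure_univ, mul_one]
  have := condDistrib_ae_eq_of_measure_eq_compProd confounders measurable_potential.aemeasurable h
  rwa [map_confounders_fullLaw] at this

lemma condDistrib_treatment_fullLaw :
    condDistrib treatment confounders (fullLaw ζ κ η : Measure (FullData 𝒳 k)) =ᵐ[ζ] η := by
  have h : (fullLaw ζ κ η : Measure (FullData 𝒳 k)).map (fun o => (confounders o, treatment o))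
      = (fullLaw ζ κ η : Measure (FullData 𝒳 k)).map confounders ⊗ₘ η := by
    rw [map_confounders_fullLaw]
    refine Measure.ext_of_lintegral _ fun f hf => ?_
    have hm := measurable_confounders.prodMk (measurable_treatment (𝒳 := 𝒳) (k := k))
    rw [lintegral_map hf hm, Measure.lintegral_compProd hf]
    refine (lintegral_fullLaw ζ κ η (hf.comp hm)).trans ?_
    refine lintegral_congr fun z => ?_
    change ∫⁻ _, ∫⁻ b, f (z, b) ∂(η z) ∂(κ z) = ∫⁻ b, f (z, b) ∂(η z)
    simp
  have := condDistrib_ae_eq_of_measure_eq_compProd confounders measurable_treatment.aemeasurable h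
  rwa [map_confounders_fullLaw] at this

/-- Conditional distributions are almost everywhere unique, so they are the prescribed kernels,
whose product was used to build the law. -/
lemma latentUnconfounded_fullLaw [StandardBorelSpace 𝒳] :
    LatentUnconfounded (fullLaw ζ κ η) := by
  refine (condIndepFun_iff_map_prod_eq_prod_condDistrib_prod_condDistrib
    measurable_potential measurable_treatment measurable_confounders).2 ?_
  rw [← Measure.compProd_eq_comp_prod, map_fullLaw, map_confounders_fullLaw]
  refine Measure.compProd_congr ?_
  filter_upwards [condDistrib_potential_fullLaw ζ κ η, condDistrib_treatment_fullLaw ζ κ η]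
    with z h1 h2
  rw [Kernel.prod_apply, Kernel.prod_apply, h1, h2]

end FullLaw

/-! ### Realizing a prescribed weight with `Y(a)` as confounder -/

section Construction

variable {𝒳 : Type*} [MeasurableSpace 𝒳] (P : ProbabilityMeasure (ObsData 𝒳)) (a : Bool)
  (w : 𝒳 × ℝ → ℝ)

/-- The density `e_a + (1 - e_a) w` of the law of `(X, Y(a))` when `Y(a)` has density `w` in the
other arm. -/
def mixedDensity (z : 𝒳 × ℝ) : ℝ := armScore P z.1 a + armScore P z.1 (!a) * w z

/-- The probability of treatment `a` given `X` and `U = Y(a)`. -/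
def tiltedScore (z : 𝒳 × ℝ) : ℝ := armScore P z.1 a / mixedDensity P a w z

/-- The law of `(X, Y(a))` with density `w` in the other arm. -/
def tiltedLaw : Measure (𝒳 × ℝ) :=
  (covariateLaw P ⊗ₘ armKernel P a).withDensity fun z => ENNReal.ofReal (mixedDensity P a w z)

variable {w}

lemma measurable_mixedDensity (hw : Measurable w) : Measurable (mixedDensity P a w) :=
  ((measurable_armScore P a).comp measurable_fst).add
    (((measurable_armScore P (!a)).comp measurable_fst).mul hw)

lemma measurable_tiltedScore (hw : Measurable w) : Measurable (tiltedScore P a w) :=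
  ((measurable_armScore P a).comp measurable_fst).div (measurable_mixedDensity P a hw)

/-- This includes points where the score of `a` vanishes: the opposite score is then `1` and the
density equals `w`. -/
lemma mixedDensity_pos (hw0 : ∀ z, 0 < w z) (z : 𝒳 × ℝ) : 0 < mixedDensity P a w z := by
  have h0 := armScore_nonneg P z.1 a
  have h1 := armScore_nonneg P z.1 (!a)
  have h2 := armScore_add_armScore_not P z.1 a
  have h3 := hw0 z
  unfold mixedDensity
  rcases h0.eq_or_lt with h | h
  · rw [← h] at h2 ⊢
    rw [zero_add] at h2
    rw [h2]; linarith
  · positivity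

lemma one_sub_tiltedScore (hw0 : ∀ z, 0 < w z) (z : 𝒳 × ℝ) :
    1 - tiltedScore P a w z = armScore P z.1 (!a) * w z / mixedDensity P a w z := by
  have h := mixedDensity_pos P a hw0 z
  unfold tiltedScore
  rw [eq_div_iff h.ne', sub_mul, div_mul_cancel₀ _ h.ne']
  unfold mixedDensity; ring

lemma tiltedScore_mem_Icc (hw0 : ∀ z, 0 < w z) (z : 𝒳 × ℝ) :
    tiltedScore P a w z ∈ Set.Icc 0 1 := by
  have h := mixedDensity_pos P a hw0 z
  have h1 := one_sub_tiltedScore P a hw0 z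
  refine ⟨div_nonneg (armScore_nonneg P _ _) h.le, ?_⟩
  have : 0 ≤ 1 - tiltedScore P a w z := by
    rw [h1]
    exact div_nonneg (mul_nonneg (armScore_nonneg P _ _) (hw0 z).le) h.le
  linarith

lemma lintegral_tiltedLaw (hw : Measurable w) {f : 𝒳 × ℝ → ENNReal} (hf : Measurable f) :
    ∫⁻ z, f z ∂(tiltedLaw P a w) = ∫⁻ x, ∫⁻ y, ENNReal.ofReal (mixedDensity P a w (x, y))
      * f (x, y) ∂(armLaw P x a) ∂(covariateLaw P) := by
  have hm := (measurable_mixedDensity P a hw).ennreal_ofReal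
  unfold tiltedLaw
  rw [lintegral_withDensity_eq_lintegral_mul _ hm hf, Measure.lintegral_compProd (hm.mul hf)]
  rfl

lemma lintegral_mixedDensity (hw : Measurable w) (hw0 : ∀ z, 0 < w z) {x : 𝒳}
    (hx : ∫⁻ y, ENNReal.ofReal (w (x, y)) ∂(armLaw P x a) = 1) :
    ∫⁻ y, ENNReal.ofReal (mixedDensity P a w (x, y)) ∂(armLaw P x a) = 1 := by
  unfold mixedDensity
  have h (y : ℝ) : ENNReal.ofReal (armScore P x a + armScore P x (!a) * w (x, y))
      = ENNReal.ofReal (armScore P x a)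
        + ENNReal.ofReal (armScore P x (!a)) * ENNReal.ofReal (w (x, y)) := by
    rw [ENNReal.ofReal_add (armScore_nonneg _ _ _)
      (mul_nonneg (armScore_nonneg _ _ _) (hw0 _).le), ENNReal.ofReal_mul (armScore_nonneg _ _ _)]
  simp_rw [h]
  rw [lintegral_add_left measurable_const, lintegral_const_mul _ (by fun_prop), hx, lintegral_const,
    measure_univ, mul_one, mul_one, ← ENNReal.ofReal_add (armScore_nonneg _ _ _)
      (armScore_nonneg _ _ _), armScore_add_armScore_not, ENNReal.ofReal_one]

lemma isProbabilityMeasure_tiltedLaw (hw : Measurable w) (hw0 : ∀ z, 0 < w z)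
    (hw1 : ∀ᵐ x ∂(covariateLaw P), ∫⁻ y, ENNReal.ofReal (w (x, y)) ∂(armLaw P x a) = 1) :
    IsProbabilityMeasure (tiltedLaw P a w) := by
  constructor
  rw [← lintegral_one]
  refine (lintegral_tiltedLaw P a hw measurable_one).trans ?_
  have : ∫⁻ x, ∫⁻ y, ENNReal.ofReal (mixedDensity P a w (x, y)) * (1 : 𝒳 × ℝ → ENNReal) (x, y)
      ∂(armLaw P x a) ∂(covariateLaw P) = ∫⁻ _, 1 ∂(covariateLaw P) := by
    refine lintegral_congr_ae ?_
    filter_upwards [hw1] with x hx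
    simpa using lintegral_mixedDensity P a hw hw0 hx
  exact this.trans (by simp)

/-- The kernel that draws treatment `a` with probability `p`. -/
def treatmentKernel {Ω : Type*} [MeasurableSpace Ω] (a : Bool) {p : Ω → ℝ} (hp : Measurable p) :
    Kernel Ω Bool where
  toFun z := ENNReal.ofReal (p z) • Measure.dirac a + ENNReal.ofReal (1 - p z) • Measure.dirac (!a)
  measurable' := by
    refine Measure.measurable_of_measurable_coe _ fun s _ => ?_
    simp only [Measure.coe_add, Measure.coe_smul, Pi.add_apply, Pi.smul_apply, smul_eq_mul]
    fun_prop

lemma treatmentKernel_apply {Ω : Type*} [MeasurableSpace Ω] {p : Ω → ℝ} (hp : Measurable p)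
    (z : Ω) : treatmentKernel a hp z
      = ENNReal.ofReal (p z) • Measure.dirac a + ENNReal.ofReal (1 - p z) • Measure.dirac (!a) := rfl

lemma isMarkovKernel_treatmentKernel {Ω : Type*} [MeasurableSpace Ω] {p : Ω → ℝ}
    (hp : Measurable p) (hp01 : ∀ z, p z ∈ Set.Icc 0 1) : IsMarkovKernel (treatmentKernel a hp) := by
  refine ⟨fun z => ⟨?_⟩⟩
  rw [treatmentKernel_apply]
  simp only [Measure.coe_add, Measure.coe_smul, Pi.add_apply, Pi.smul_apply, smul_eq_mul,
    measure_univ, mul_one]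
  rw [← ENNReal.ofReal_add (hp01 z).1 (by linarith [(hp01 z).2])]
  simp

lemma lintegral_treatmentKernel {Ω : Type*} [MeasurableSpace Ω] {p : Ω → ℝ} (hp : Measurable p)
    (z : Ω) (f : Bool → ENNReal) : ∫⁻ b, f b ∂(treatmentKernel a hp z)
      = ENNReal.ofReal (p z) * f a + ENNReal.ofReal (1 - p z) * f (!a) := by
  rw [treatmentKernel_apply, lintegral_add_measure, lintegral_smul_measure, lintegral_smul_measure,
    lintegral_dirac, lintegral_dirac]
  rfl

lemma treatmentKernel_real_self {Ω : Type*} [MeasurableSpace Ω] {p : Ω → ℝ} (hp : Measurable p)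
    {z : Ω} (hz : 0 ≤ p z) : (treatmentKernel a hp z).real {a} = p z := by
  rw [treatmentKernel_apply, Measure.real]
  simp [ENNReal.toReal_ofReal hz]

lemma treatmentKernel_real_not {Ω : Type*} [MeasurableSpace Ω] {p : Ω → ℝ} (hp : Measurable p)
    {z : Ω} (hz : p z ≤ 1) : (treatmentKernel a hp z).real {!a} = 1 - p z := by
  rw [treatmentKernel_apply, Measure.real]
  simp [ENNReal.toReal_ofReal (sub_nonneg.2 hz)]

/-- The kernel that draws `Y(¬a)` from the observed arm `¬a`, and puts `Y(a)` equal to the `i`-th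
confounder. -/
def potentialKernel {k : ℕ} (i : Fin k) : Kernel (𝒳 × (Fin k → ℝ)) (Bool → ℝ) :=
  (Kernel.id ×ₖ (armKernel P (!a)).comap Prod.fst measurable_fst).map
    fun v b => if b = a then v.1.2 i else v.2

lemma measurable_potentialKernel_map {k : ℕ} (i : Fin k) :
    Measurable fun (v : (𝒳 × (Fin k → ℝ)) × ℝ) (b : Bool) => if b = a then v.1.2 i else v.2 := by
  refine measurable_pi_lambda _ fun b => ?_
  split_ifs <;> fun_prop

instance isMarkovKernel_potentialKernel {k : ℕ} (i : Fin k) :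
    IsMarkovKernel (potentialKernel P a i) :=
  Kernel.IsMarkovKernel.map _ (measurable_potentialKernel_map a i)

lemma lintegral_potentialKernel {k : ℕ} (i : Fin k) (z : 𝒳 × (Fin k → ℝ))
    {f : (Bool → ℝ) → ENNReal} (hf : Measurable f) : ∫⁻ y, f y ∂(potentialKernel P a i z)
      = ∫⁻ y, f (fun b => if b = a then z.2 i else y) ∂(armLaw P z.1 (!a)) := by
  have hm := measurable_potentialKernel_map (𝒳 := 𝒳) a i
  unfold potentialKernel
  rw [Kernel.lintegral_map _ hm _ hf]
  exact Kernel.lintegral_id_prod (hf.comp hm) ((armKernel P (!a)).comap Prod.fst measurable_fst) z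

/-- A law in the uncertainty set under which `Y(a)` is the only confounder and has density `w` in
the arm `¬a`. -/
theorem exists_mem_uncertaintySet [StandardBorelSpace 𝒳] {k : ℕ} (hk : 1 ≤ k) {Λ : ℝ} (hΛ : 1 ≤ Λ)
    (hpos : ∀ᵐ x ∂(covariateLaw P), ∀ b, 0 < armScore P x b)
    (hw : Measurable w) (hwΛ : ∀ z, w z ∈ Set.Icc (1 / Λ) Λ)
    (hw1 : ∀ᵐ x ∂(covariateLaw P), ∫⁻ y, ENNReal.ofReal (w (x, y)) ∂(armLaw P x a) = 1) :
    ∃ Q ∈ uncertaintySet k Λ P, ∀ᵐ x ∂(covariateLaw P), potentialLaw Q x a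
      = (armLaw P x a).withDensity fun y => ENNReal.ofReal (mixedDensity P a w (x, y)) := by
  have hΛ0 : 0 < Λ := by linarith
  have hw0 (z) : 0 < w z := lt_of_lt_of_le (by positivity) (hwΛ z).1
  have hprob := isProbabilityMeasure_tiltedLaw P a hw hw0 hw1
  -- Every coordinate of `U` is set to `Y(a)`; `k ≥ 1` supplies a coordinate from which it is read
  -- back.
  let i : Fin k := ⟨0, hk⟩
  let ι : 𝒳 × ℝ → 𝒳 × (Fin k → ℝ) := fun v => (v.1, fun _ => v.2)
  have hι : Measurable ι := by fun_prop
  have hp : Measurable fun z : 𝒳 × (Fin k → ℝ) => tiltedScore P a w (z.1, z.2 i) :=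
    (measurable_tiltedScore P a hw).comp (by fun_prop)
  have hη := isMarkovKernel_treatmentKernel a hp fun z => tiltedScore_mem_Icc P a hw0 _
  have hζ : IsProbabilityMeasure ((tiltedLaw P a w).map ι) :=
    Measure.isProbabilityMeasure_map hι.aemeasurable
  let Q : ProbabilityMeasure (FullData 𝒳 k) :=
    fullLaw ((tiltedLaw P a w).map ι) (potentialKernel P a i) (treatmentKernel a hp)
  -- The density `G = e + e' w` cancels against the treatment probabilities: `G (e / G) = e` and `G
  -- (1 - e / G) = e' w`.
  have hQint {f : FullData 𝒳 k → ENNReal} (hf : Measurable f) :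
      ∫⁻ o, f o ∂(Q : Measure (FullData 𝒳 k)) = ∫⁻ x, ∫⁻ u, ∫⁻ y,
        (ENNReal.ofReal (armScore P x a)
            * f (x, fun b => if b = a then u else y, a, fun _ => u)
          + ENNReal.ofReal (armScore P x (!a) * w (x, u))
            * f (x, fun b => if b = a then u else y, !a, fun _ => u))
        ∂(armLaw P x (!a)) ∂(armLaw P x a) ∂(covariateLaw P) := by
    have hH := measurable_lintegral_lintegral (potentialKernel P a i) (treatmentKernel a hp) hf
    refine (lintegral_fullLaw _ _ _ hf).trans ?_
    rw [lintegral_map hH hι]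
    refine (lintegral_tiltedLaw P a hw (hH.comp hι)).trans ?_
    simp only [Function.comp_apply]
    refine lintegral_congr fun x => lintegral_congr fun u => ?_
    simp only [lintegral_treatmentKernel]
    have hpair : Measurable fun (y : ℝ) (b : Bool) => if b = a then u else y :=
      measurable_pi_lambda _ fun b => by split_ifs <;> fun_prop
    have hfm (t : Bool) (u' : Fin k → ℝ) :
        Measurable fun y : ℝ => f (x, fun b => if b = a then u else y, t, u') :=
      hf.comp (measurable_const.prodMk (hpair.prodMk measurable_const))
    rw [lintegral_potentialKernel P a i _ (by fun_prop)]
    refine (lintegral_const_mul _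
      (by exact ((hfm a _).const_mul _).add ((hfm (!a) _).const_mul _))).symm.trans ?_
    refine lintegral_congr fun y => ?_
    have hG := mixedDensity_pos P a hw0 (x, u)
    rw [mul_add, ← mul_assoc, ← mul_assoc, ← ENNReal.ofReal_mul hG.le, ← ENNReal.ofReal_mul hG.le]
    change ENNReal.ofReal (mixedDensity P a w (x, u) * tiltedScore P a w (x, u)) * _
      + ENNReal.ofReal (mixedDensity P a w (x, u) * (1 - tiltedScore P a w (x, u))) * _ = _
    rw [one_sub_tiltedScore P a hw0, mul_div_cancel₀ _ hG.ne']
    unfold tiltedScore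
    rw [mul_div_cancel₀ _ hG.ne']
  -- Arm `a` carries weight `e` and the right outcome law. In the other arm the outcome is
  -- independent of `U` given `X`, and `w` integrates to one, leaving weight `e'`.
  have hobs : observedLaw Q = P := by
    refine Subtype.ext (Measure.ext_of_lintegral _ fun f hf => ?_)
    change ∫⁻ v, f v ∂((Q : Measure (FullData 𝒳 k)).map observe)
      = ∫⁻ v, f v ∂(P : Measure (ObsData 𝒳))
    rw [lintegral_map hf measurable_observe, lintegral_obsData P hf]
    refine (hQint (hf.comp measurable_observe)).trans ?_
    refine lintegral_congr_ae ?_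
    filter_upwards [hw1] with x hx
    have h1 (u : ℝ) : ∫⁻ y, (ENNReal.ofReal (armScore P x a) * f (x, u, a)
          + ENNReal.ofReal (armScore P x (!a) * w (x, u)) * f (x, y, !a)) ∂(armLaw P x (!a))
        = ENNReal.ofReal (armScore P x a) * f (x, u, a) + ENNReal.ofReal (w (x, u))
          * (ENNReal.ofReal (armScore P x (!a)) * ∫⁻ y, f (x, y, !a) ∂(armLaw P x (!a))) := by
      rw [lintegral_add_left measurable_const, lintegral_const, measure_univ, mul_one,
        lintegral_const_mul _ (by fun_prop), ENNReal.ofReal_mul (armScore_nonneg _ _ _)]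
      ring
    have h2 : ∀ u y : ℝ, (f ∘ observe)
        ((x, fun b => if b = a then u else y, a, fun _ => u) : FullData 𝒳 k) = f (x, u, a) := by
      intro u y; simp [observe]
    have h3 : ∀ u y : ℝ, (f ∘ observe)
        ((x, fun b => if b = a then u else y, !a, fun _ => u) : FullData 𝒳 k) = f (x, y, !a) := by
      intro u y; simp [observe]
    simp only [h2, h3, h1]
    rw [lintegral_add_left (by fun_prop), lintegral_mul_const _ (by fun_prop), hx, one_mul,
      lintegral_const_mul _ (by fun_prop)]
    cases a <;> simp [add_comm]
  have hcov : (Q : Measure (FullData 𝒳 k)).map covariate = covariateLaw P := by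
    rw [← covariateLaw_observedLaw, hobs]
  have hmsm : MSM Λ Q := by
    refine ⟨latentUnconfounded_fullLaw _ _ _, ?_⟩
    have hA : condDistrib treatment confounders (Q : Measure (FullData 𝒳 k))
        =ᵐ[(Q : Measure (FullData 𝒳 k)).map confounders] treatmentKernel a hp := by
      rw [show (Q : Measure (FullData 𝒳 k)).map confounders = _ from map_confounders_fullLaw _ _ _]
      exact condDistrib_treatment_fullLaw _ _ _
    rw [← hcov] at hpos
    filter_upwards [ae_of_ae_map measurable_confounders.aemeasurable hA,
      ae_of_ae_map measurable_covariate.aemeasurable hpos] with o hη' he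
    have hn : nominalScore Q (covariate o) = armScore P (covariate o) true := by
      rw [nominalScore_eq_armScore, hobs]
    have hn' : 1 - armScore P (covariate o) true = armScore P (covariate o) false := by
      rw [← armScore_add_armScore_not P (covariate o) true]; simp
    set v : 𝒳 × ℝ := ((confounders o).1, (confounders o).2 i) with hv
    have hmem := tiltedScore_mem_Icc P a hw0 v
    have hsub := one_sub_tiltedScore P a hw0 v
    have hG := mixedDensity_pos P a hw0 v
    have ht : trueScore Q (confounders o) = (treatmentKernel a hp (confounders o)).real {true} := by
      unfold trueScore; exact congrArg (fun μ : Measure Bool => μ.real {true}) hη'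
    have hew := hw0 v
    have he1 := he true
    have he0 := he false
    have hcv : v.1 = covariate o := rfl
    rw [ht, hn, hn']
    -- The odds refer to treatment `true`, so the ratio is `w` when `a = false` and `1 / w` when `a
    -- = true`; the interval `[1 / Λ, Λ]` is stable under inversion.
    cases a
    · have h1 : (treatmentKernel false hp (confounders o)).real {true}
          = 1 - tiltedScore P false w v := treatmentKernel_real_not false hp hmem.2
      rw [h1, sub_sub_cancel, hsub]
      unfold tiltedScore
      rw [hcv, Bool.not_false]
      have : armScore P (covariate o) true * w v / mixedDensity P false w v
          / (armScore P (covariate o) false / mixedDensity P false w v)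
          / (armScore P (covariate o) true / armScore P (covariate o) false) = w v := by
        field_simp
      rw [this]
      exact hwΛ v
    · have h1 : (treatmentKernel true hp (confounders o)).real {true}
          = tiltedScore P true w v := treatmentKernel_real_self true hp hmem.1
      rw [h1, hsub]
      unfold tiltedScore
      rw [hcv, Bool.not_true]
      have : armScore P (covariate o) true / mixedDensity P true w v
          / (armScore P (covariate o) false * w v / mixedDensity P true w v)
          / (armScore P (covariate o) true / armScore P (covariate o) false) = 1 / w v := by
        field_simp
      rw [this]
      refine ⟨one_div_le_one_div_of_le hew (hwΛ v).2, ?_⟩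
      rw [div_le_iff₀ hew]
      have h2 := (hwΛ v).1
      rw [div_le_iff₀ hΛ0] at h2
      linarith
  refine ⟨Q, ⟨hmsm, hobs⟩, ?_⟩
  rw [← hcov]
  refine ae_potentialLaw_eq_withDensity (κ := armKernel P a) (measurable_mixedDensity P a hw)
    (B := 1 + Λ) ?_ ?_
  · intro z
    have h0 := armScore_nonneg P z.1 (!a)
    have h1 := armScore_nonneg P z.1 a
    have h2 := armScore_add_armScore_not P z.1 a
    have h3 := (hwΛ z).2
    unfold mixedDensity
    nlinarith
  -- Summing over the treatment adds the weights `e` and `e' w`, which is the density of the tilted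
  -- law.
  · rw [hcov]
    change _ = tiltedLaw P a w
    have hm : Measurable fun o : FullData 𝒳 k => (covariate o, potential o a) :=
      measurable_covariate.prodMk ((measurable_pi_apply a).comp measurable_potential)
    refine Measure.ext_of_lintegral _ fun f hf => ?_
    rw [lintegral_map hf hm, lintegral_tiltedLaw P a hw hf]
    refine (hQint (hf.comp hm)).trans ?_
    refine lintegral_congr fun x => lintegral_congr fun u => ?_
    have h2 : ∀ (y : ℝ) (t : Bool), (f ∘ fun o : FullData 𝒳 k => (covariate o, potential o a))
        (x, fun b => if b = a then u else y, t, fun _ => u) = f (x, u) := by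
      intro y t; simp [covariate, potential]
    simp only [h2]
    rw [lintegral_const, measure_univ, mul_one, ← add_mul, ← ENNReal.ofReal_add
      (armScore_nonneg _ _ _) (mul_nonneg (armScore_nonneg _ _ _) (hw0 _).le)]
    rfl

end Construction

/-! ### Means under a density -/

section Density

variable {μ : Measure ℝ} {g : ℝ → ℝ}

lemma integrable_withDensity_ofReal (hμ : Integrable (fun y => y) μ) (hg : Measurable g)
    (hg0 : ∀ y, 0 ≤ g y) {B : ℝ} (hB : ∀ y, g y ≤ B) :
    Integrable (fun y => y) (μ.withDensity fun y => ENNReal.ofReal (g y)) := by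
  rw [integrable_withDensity_iff hg.ennreal_ofReal (by simp)]
  simp_rw [ENNReal.toReal_ofReal (hg0 _)]
  exact hμ.mul_bdd (c := B) hg.aestronglyMeasurable
    (Filter.Eventually.of_forall fun y => by rw [Real.norm_of_nonneg (hg0 y)]; exact hB y)

lemma integral_withDensity_ofReal (hg : Measurable g) (hg0 : ∀ y, 0 ≤ g y) :
    ∫ y, y ∂(μ.withDensity fun y => ENNReal.ofReal (g y)) = ∫ y, y * g y ∂μ := by
  rw [integral_withDensity_eq_integral_toReal_smul hg.ennreal_ofReal (by simp)]
  simp_rw [ENNReal.toReal_ofReal (hg0 _), smul_eq_mul, mul_comm]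

lemma integral_eq_one_of_isProbabilityMeasure_withDensity (hg : Measurable g) (hg0 : ∀ y, 0 ≤ g y)
    (h : IsProbabilityMeasure (μ.withDensity fun y => ENNReal.ofReal (g y))) :
    ∫ y, g y ∂μ = 1 := by
  rw [integral_eq_lintegral_of_nonneg_ae (Filter.Eventually.of_forall hg0)
    hg.aestronglyMeasurable, ← setLIntegral_univ, ← withDensity_apply _ MeasurableSet.univ,
    measure_univ, ENNReal.toReal_one]

end Density

/-! ### Extremal means: attainment, optimality and closed form -/

section Optimal

variable {𝒳 : Type*} [MeasurableSpace 𝒳] (P : ProbabilityMeasure (ObsData 𝒳)) (a : Bool)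
  (p α β : ℝ)

instance isProbabilityMeasure_potentialLaw {k : ℕ} (Q : ProbabilityMeasure (FullData 𝒳 k)) (x : 𝒳)
    (b : Bool) : IsProbabilityMeasure (potentialLaw Q x b) := by
  unfold potentialLaw; infer_instance

/-- The threshold weight with respect to the observed arm `a`. -/
def armWeight (z : 𝒳 × ℝ) : ℝ := thresholdWeight (armLaw P z.1 a) p α β z.2

/-- The conditional mean of `Y(a)` when `Y(a)` has the threshold weight as its density in the
other arm. -/
def optimalMean (x : 𝒳) : ℝ :=
  ∫ y, y * mixedDensity P a (armWeight P a p α β) (x, y) ∂(armLaw P x a)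

variable {p α β}

lemma measurable_armWeight (hp0 : 0 < p) (hp1 : p < 1) : Measurable (armWeight P a p α β) :=
  measurable_uncurry_thresholdWeight (armKernel P a) hp0 hp1 α β

lemma measurable_optimalMean (hp0 : 0 < p) (hp1 : p < 1) :
    Measurable (optimalMean P a p α β) := by
  have h : Measurable fun z : 𝒳 × ℝ => z.2 * mixedDensity P a (armWeight P a p α β) z :=
    measurable_snd.mul (measurable_mixedDensity P a (measurable_armWeight P a hp0 hp1))
  exact (h.stronglyMeasurable.integral_kernel_prod_right' (κ := armKernel P a)).measurable

/-- The mean under the threshold weight is attained in the uncertainty set. -/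
theorem exists_mem_uncertaintySet_condMean_eq [StandardBorelSpace 𝒳] {k : ℕ} (hk : 1 ≤ k) {Λ : ℝ}
    (hΛ : 1 ≤ Λ) (hpos : ∀ᵐ x ∂(covariateLaw P), ∀ b, 0 < armScore P x b)
    (hp0 : 0 < p) (hp1 : p < 1) (hα : α ∈ Set.Icc (1 / Λ) Λ) (hβ : β ∈ Set.Icc (1 / Λ) Λ)
    (hsum : p * α + (1 - p) * β = 1) :
    ∃ Q ∈ uncertaintySet k Λ P, ∀ᵐ x ∂(covariateLaw P), condMean Q x a
      = optimalMean P a p α β x := by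
  have hΛ0 : 0 < 1 / Λ := one_div_pos.2 (by linarith)
  have hw := measurable_armWeight P a (α := α) (β := β) hp0 hp1
  have hwΛ (z : 𝒳 × ℝ) : armWeight P a p α β z ∈ Set.Icc (1 / Λ) Λ :=
    thresholdWeight_mem_Icc hp0 hp1 hα hβ _
  have hw0 (z : 𝒳 × ℝ) : 0 < armWeight P a p α β z := hΛ0.trans_le (hwΛ z).1
  obtain ⟨Q, hQ, hpot⟩ := exists_mem_uncertaintySet P a hk hΛ hpos hw hwΛ
    (Filter.Eventually.of_forall fun x => by
      have hint : Integrable (fun y => armWeight P a p α β (x, y)) (armLaw P x a) :=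
        .of_bound (hw.comp measurable_prodMk_left).aestronglyMeasurable Λ
          (Filter.Eventually.of_forall fun y => by
            rw [Real.norm_of_nonneg (hw0 _).le]; exact (hwΛ _).2)
      rw [← ofReal_integral_eq_lintegral_ofReal hint
        (Filter.Eventually.of_forall fun y => (hw0 _).le)]
      have h1 : ∫ y, armWeight P a p α β (x, y) ∂(armLaw P x a) = 1 :=
        (integral_thresholdWeight hp0 hp1).trans hsum
      rw [h1, ENNReal.ofReal_one])
  refine ⟨Q, hQ, ?_⟩
  filter_upwards [hpot] with x hx
  unfold condMean optimalMean
  rw [hx]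
  exact integral_withDensity_ofReal ((measurable_mixedDensity P a hw).comp measurable_prodMk_left)
    fun y => (mixedDensity_pos P a hw0 _).le

/-- Under the marginal sensitivity model `Y(a)` is conditionally integrable, and its conditional mean
lies between the means under the two extreme threshold weights. -/
theorem MSM.ae_condMean_bounds [StandardBorelSpace 𝒳] {k : ℕ} {Λ : ℝ} (hΛ : 1 ≤ Λ)
    {Q : ProbabilityMeasure (FullData 𝒳 k)} (hQ : MSM Λ Q) (hobs : observedLaw Q = P)
    (hint : ∀ᵐ x ∂(covariateLaw P), Integrable (fun y : ℝ => y) (armLaw P x a)) :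
    ∀ᵐ x ∂(covariateLaw P), Integrable (fun y : ℝ => y) (potentialLaw Q x a) ∧
      ∀ p, 0 < p → p < 1 →
        (p * (1 / Λ) + (1 - p) * Λ = 1 → condMean Q x a ≤ optimalMean P a p (1 / Λ) Λ x) ∧
        (p * Λ + (1 - p) * (1 / Λ) = 1 → optimalMean P a p Λ (1 / Λ) x ≤ condMean Q x a) := by
  subst hobs
  have hΛ0 : 0 < Λ := by linarith
  have hΛi : 0 < 1 / Λ := by positivity
  have hle : 1 / Λ ≤ Λ := by rw [div_le_iff₀ hΛ0]; nlinarith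
  obtain ⟨g, hg, hmem, hpot⟩ := hQ.exists_density hΛ a
  filter_upwards [hpot, hint] with x hx hix
  set P := observedLaw Q
  have he0 := armScore_nonneg P x (!a)
  have he1 := armScore_nonneg P x a
  have hadd := armScore_add_armScore_not P x a
  have hgx : Measurable fun y => g (x, y) := hg.comp measurable_prodMk_left
  have hlo (y : ℝ) : armScore P x a + 1 / Λ * armScore P x (!a) ≤ g (x, y) := (hmem (x, y)).1
  have hup (y : ℝ) : g (x, y) ≤ armScore P x a + Λ * armScore P x (!a) := (hmem (x, y)).2
  have hg0 (y : ℝ) : 0 ≤ g (x, y) := le_trans (by positivity) (hlo y)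
  have hgB (y : ℝ) : g (x, y) ≤ 1 + Λ := (hup y).trans (by nlinarith)
  have hone : ∫ y, g (x, y) ∂(armLaw P x a) = 1 := by
    refine integral_eq_one_of_isProbabilityMeasure_withDensity hgx hg0 ?_
    rw [← hx]; infer_instance
  have hmean : condMean Q x a = ∫ y, y * g (x, y) ∂(armLaw P x a) := by
    unfold condMean
    rw [hx, integral_withDensity_ofReal hgx hg0]
  -- The exchange inequality needs the competitor to be bounded and to have the same total mass as
  -- `g`; the normalization of `p`, `α`, `β` provides the latter.
  have hthr (p α β : ℝ) (hp0 : 0 < p) (hp1 : p < 1) (hα : α ∈ Set.Icc (1 / Λ) Λ)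
      (hβ : β ∈ Set.Icc (1 / Λ) Λ) (hsum : p * α + (1 - p) * β = 1) :
      Measurable (fun y => mixedDensity P a (armWeight P a p α β) (x, y)) ∧
      (∀ y, |mixedDensity P a (armWeight P a p α β) (x, y)| ≤ 1 + Λ) ∧
      ∫ y, mixedDensity P a (armWeight P a p α β) (x, y) ∂(armLaw P x a) = 1 := by
    have hw := (measurable_thresholdWeight (armLaw P x a) p α β)
    have hwΛ (y : ℝ) : armWeight P a p α β (x, y) ∈ Set.Icc (1 / Λ) Λ :=
      thresholdWeight_mem_Icc hp0 hp1 hα hβ _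
    have hiw : Integrable (fun y => armWeight P a p α β (x, y)) (armLaw P x a) :=
      .of_bound hw.aestronglyMeasurable Λ (Filter.Eventually.of_forall fun y => by
        rw [Real.norm_of_nonneg (hΛi.le.trans (hwΛ y).1)]; exact (hwΛ _).2)
    refine ⟨(hw.const_mul (armScore P x (!a))).const_add (armScore P x a), fun y => ?_, ?_⟩
    · have h1 := (hwΛ y).1
      have h2 := (hwΛ y).2
      have h3 : 0 ≤ armWeight P a p α β (x, y) := hΛi.le.trans h1
      unfold mixedDensity
      rw [abs_of_nonneg (by positivity)]
      dsimp only
      nlinarith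
    · have h1 : ∫ y, armWeight P a p α β (x, y) ∂(armLaw P x a) = 1 :=
        (integral_thresholdWeight hp0 hp1).trans hsum
      refine (integral_add (integrable_const (armScore P x a))
        (hiw.const_mul (armScore P x (!a)))).trans ?_
      rw [integral_const_mul, h1]
      simp [hadd]
  have hbelow (p α β y : ℝ) (h : y < quantile (armLaw P x a) p) :
      mixedDensity P a (armWeight P a p α β) (x, y)
        = armScore P x a + α * armScore P x (!a) := by
    unfold mixedDensity armWeight thresholdWeight
    rw [if_pos h, mul_comm]
  have habove (p α β y : ℝ) (h : quantile (armLaw P x a) p < y) :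
      mixedDensity P a (armWeight P a p α β) (x, y)
        = armScore P x a + β * armScore P x (!a) := by
    unfold mixedDensity armWeight thresholdWeight
    rw [if_neg (not_lt.2 h.le), if_neg h.ne', mul_comm]
  have hgabs (y : ℝ) : |g (x, y)| ≤ 1 + Λ := by rw [abs_of_nonneg (hg0 y)]; exact hgB y
  refine ⟨by rw [hx]; exact integrable_withDensity_ofReal hix hgx hg0 hgB, fun p hp0 hp1 =>
    ⟨fun hsum => ?_, fun hsum => ?_⟩⟩
  · obtain ⟨h1, h2, h3⟩ := hthr p (1 / Λ) Λ hp0 hp1 ⟨le_rfl, hle⟩ ⟨hle, le_rfl⟩ hsum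
    rw [hmean]
    -- The extremal density sits at the lower bound for `g` below the quantile and at the upper
    -- bound above it. No comparison is needed on the atom.
    exact integral_mul_le_integral_mul_of_threshold (quantile (armLaw P x a) p) hix
      hgx.aestronglyMeasurable h1.aestronglyMeasurable
      (Filter.Eventually.of_forall hgabs) (Filter.Eventually.of_forall h2)
      (Filter.Eventually.of_forall fun y hy => by rw [hbelow p _ _ y hy]; exact hlo y)
      (Filter.Eventually.of_forall fun y hy => by rw [habove p _ _ y hy]; exact hup y)
      (hone.trans h3.symm)
  · obtain ⟨h1, h2, h3⟩ := hthr p Λ (1 / Λ) hp0 hp1 ⟨hle, le_rfl⟩ ⟨le_rfl, hle⟩ hsum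
    rw [hmean]
    -- The same exchange with the roles of `g` and the extremal density swapped.
    exact integral_mul_le_integral_mul_of_threshold (quantile (armLaw P x a) p) hix
      h1.aestronglyMeasurable hgx.aestronglyMeasurable
      (Filter.Eventually.of_forall h2) (Filter.Eventually.of_forall hgabs)
      (Filter.Eventually.of_forall fun y hy => by rw [hbelow p _ _ y hy]; exact hup y)
      (Filter.Eventually.of_forall fun y hy => by rw [habove p _ _ y hy]; exact hlo y)
      (h3.trans hone.symm)

/-- At an exact quantile the optimal mean is the mean of `Y 1{A = a}`, reweighted by a function
that takes one value below the quantile and one value above it. -/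
lemma ae_optimalMean_eq_integral (hpos : ∀ᵐ x ∂(covariateLaw P), ∀ b, 0 < armScore P x b)
    (hint : ∀ᵐ x ∂(covariateLaw P), Integrable (fun y : ℝ => y) (armLaw P x a)) :
    ∀ᵐ x ∂(covariateLaw P), ∀ p α β : ℝ,
      (α = β ∨ (armLaw P x a).real (Set.Iio (armQuantile P p x a)) = p) →
      Integrable (fun v : ℝ × Bool => v.1 * (if v.2 = a then 1 else 0) *
          (1 + (1 - armScore P x a) / armScore P x a
            * if v.1 < armQuantile P p x a then α else β)) (outcomeArmLaw P x) ∧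
        optimalMean P a p α β x = ∫ v, v.1 * (if v.2 = a then 1 else 0) *
          (1 + (1 - armScore P x a) / armScore P x a
            * if v.1 < armQuantile P p x a then α else β) ∂(outcomeArmLaw P x) := by
  filter_upwards [hpos, hint, ae_outcomeArmLaw_eq_sum P] with x hx hix heq p α β hex
  set f : ℝ × Bool → ℝ := fun v => v.1 * (if v.2 = a then 1 else 0) *
    (1 + (1 - armScore P x a) / armScore P x a * if v.1 < armQuantile P p x a then α else β) with hf
  have hfm : Measurable f := by
    refine (measurable_fst.mul (Measurable.ite (measurableSet_eq_fun measurable_snd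
      measurable_const) measurable_const measurable_const)).mul
      (measurable_const.add (Measurable.const_mul (Measurable.ite (measurableSet_lt measurable_fst
        measurable_const) measurable_const measurable_const) _))
  -- The score of the arm turns the inverse-probability factor into the density: `e (1 + (1 - e) / e
  -- * w) = e + (1 - e) w`.
  have hfa (y : ℝ) : armScore P x a * f (y, a)
      = y * mixedDensity P a (armWeight P a p α β) (x, y) := by
    have h1 : armScore P x (!a) = 1 - armScore P x a := by
      rw [← armScore_add_armScore_not P x a]; ring
    have h2 : armWeight P a p α β (x, y) = if y < armQuantile P p x a then α else β :=
      thresholdWeight_of_exact hex y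
    unfold mixedDensity
    simp only [hf, if_true]
    rw [h2, h1]
    have := (hx a).ne'
    field_simp
  have hfn (y : ℝ) : f (y, !a) = 0 := by simp [hf]
  have hfai : Integrable (fun y => f (y, a)) (armLaw P x a) := by
    have hc : Measurable fun y : ℝ => 1 + (1 - armScore P x a) / armScore P x a
        * if y < armQuantile P p x a then α else β :=
      measurable_const.add (Measurable.const_mul (Measurable.ite measurableSet_Iio
        measurable_const measurable_const) _)
    have h := hix.mul_bdd (c := 1 + |(1 - armScore P x a) / armScore P x a| * (|α| + |β|))
      hc.aestronglyMeasurable (Filter.Eventually.of_forall fun y => by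
        refine (abs_add_le _ _).trans ?_
        rw [abs_one, abs_mul]
        gcongr
        split_ifs
        · linarith [abs_nonneg β]
        · linarith [abs_nonneg α])
    refine h.congr (Filter.Eventually.of_forall fun y => ?_)
    simp [hf]
  have hib (b : Bool) : Integrable f
      (ENNReal.ofReal (armScore P x b) • (armLaw P x b).map (fun y => (y, b))) := by
    refine Integrable.smul_measure ?_ ENNReal.ofReal_ne_top
    rw [integrable_map_measure hfm.aestronglyMeasurable (by fun_prop)]
    by_cases hb : b = a
    · subst hb; exact hfai
    · have hb' : b = !a := by cases a <;> cases b <;> simp_all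
      subst hb'
      simp [Function.comp_def, hfn]
  rw [heq]
  refine ⟨integrable_finsetSum_measure.2 fun b _ => hib b, ?_⟩
  have hb (b : Bool) : ∫ v, f v ∂(ENNReal.ofReal (armScore P x b) •
      (armLaw P x b).map (fun y => (y, b))) = ∫ y, armScore P x b * f (y, b) ∂(armLaw P x b) := by
    rw [integral_smul_measure, integral_map (by fun_prop) hfm.aestronglyMeasurable,
      ENNReal.toReal_ofReal (armScore_nonneg _ _ _), integral_const_mul, smul_eq_mul]
  have ha : ∫ y, armScore P x a * f (y, a) ∂(armLaw P x a) = optimalMean P a p α β x := by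
    simp_rw [hfa]; rfl
  have hn : ∫ y, armScore P x (!a) * f (y, !a) ∂(armLaw P x (!a)) = 0 := by
    simp [hfn]
  rw [integral_finsetSum_measure fun b _ => hib b]
  simp_rw [hb]
  rw [← ha, ← add_zero (∫ y, armScore P x a * f (y, a) ∂(armLaw P x a)), ← hn]
  cases a
  · simp [add_comm]
  · simp

end Optimal

/-! ### Sign exponents as threshold weights -/

section Sharpness

variable {𝒳 : Type*} [MeasurableSpace 𝒳] (P : ProbabilityMeasure (ObsData 𝒳)) (a : Bool)

/-- The convention `sgn 0 = 1` puts the quantile itself on the upper side, in agreement with the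
strict inequality in the threshold. -/
lemma upperIntegrand_eq (Λ : ℝ) (x : 𝒳) : upperIntegrand P Λ x a = fun v =>
    v.1 * (if v.2 = a then 1 else 0) * (1 + (1 - armScore P x a) / armScore P x a
      * if v.1 < armQuantile P (Λ / (1 + Λ)) x a then 1 / Λ else Λ) := by
  funext v
  unfold upperIntegrand upperQuantile sgn
  by_cases h : v.1 < armQuantile P (Λ / (1 + Λ)) x a
  · rw [if_pos h, if_neg (not_le.2 (sub_neg.2 h) : ¬ 0 ≤ v.1 - _)]
    simp
  · rw [if_neg h, if_pos (sub_nonneg.2 (not_lt.1 h) : 0 ≤ v.1 - _)]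
    simp

lemma lowerIntegrand_eq (Λ : ℝ) (x : 𝒳) : lowerIntegrand P Λ x a = fun v =>
    v.1 * (if v.2 = a then 1 else 0) * (1 + (1 - armScore P x a) / armScore P x a
      * if v.1 < armQuantile P (1 / (1 + Λ)) x a then Λ else 1 / Λ) := by
  funext v
  unfold lowerIntegrand lowerQuantile sgn
  by_cases h : v.1 < armQuantile P (1 / (1 + Λ)) x a
  · rw [if_pos h, if_neg (not_le.2 (sub_neg.2 h) : ¬ 0 ≤ v.1 - _)]
    simp
  · rw [if_neg h, if_pos (sub_nonneg.2 (not_lt.1 h) : 0 ≤ v.1 - _)]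
    simp

end Sharpness

end SensitivityModel

end

/-! ### Sharp bounds -/

theorem propositionA1 {𝒳 : Type*} [MeasurableSpace 𝒳] [StandardBorelSpace 𝒳]
    (k : ℕ) (hk : 1 ≤ k) (Λ : ℝ) (hΛ : 1 ≤ Λ)
    (Po : ProbabilityMeasure (SensitivityModel.FullData 𝒳 k))
    (hMSM : SensitivityModel.MSM Λ Po)
    (P : ProbabilityMeasure (SensitivityModel.ObsData 𝒳))
    (hP : P = SensitivityModel.observedLaw Po)
    (hY : ∀ᵐ x ∂(SensitivityModel.covariateLaw P),
      Integrable (fun y : ℝ => y) (SensitivityModel.outcomeLaw P x))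
    (a : Bool) :
    (∀ Q ∈ SensitivityModel.uncertaintySet k Λ P, ∀ᵐ x ∂(SensitivityModel.covariateLaw P),
      Integrable (fun y : ℝ => y) (SensitivityModel.potentialLaw Q x a)) ∧
    (∃ μup : 𝒳 → ℝ, SensitivityModel.IsSharpUpper k Λ P a μup ∧
      (∃ Pup ∈ SensitivityModel.uncertaintySet k Λ P,
        ∀ᵐ x ∂(SensitivityModel.covariateLaw P), SensitivityModel.condMean Pup x a = μup x) ∧
      ∀ᵐ x ∂(SensitivityModel.covariateLaw P),
        (1 < Λ → (SensitivityModel.armLaw P x a).real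
          (Set.Iio (SensitivityModel.upperQuantile P Λ x a)) = Λ / (1 + Λ)) →
        Integrable (SensitivityModel.upperIntegrand P Λ x a)
          (SensitivityModel.outcomeArmLaw P x) ∧
        μup x = ∫ v, SensitivityModel.upperIntegrand P Λ x a v
          ∂(SensitivityModel.outcomeArmLaw P x)) ∧
    (∃ μlo : 𝒳 → ℝ, SensitivityModel.IsSharpLower k Λ P a μlo ∧
      (∃ Plo ∈ SensitivityModel.uncertaintySet k Λ P,
        ∀ᵐ x ∂(SensitivityModel.covariateLaw P), SensitivityModel.condMean Plo x a = μlo x) ∧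
      ∀ᵐ x ∂(SensitivityModel.covariateLaw P),
        (1 < Λ → (SensitivityModel.armLaw P x a).real
          (Set.Iio (SensitivityModel.lowerQuantile P Λ x a)) = 1 / (1 + Λ)) →
        Integrable (SensitivityModel.lowerIntegrand P Λ x a)
          (SensitivityModel.outcomeArmLaw P x) ∧
        μlo x = ∫ v, SensitivityModel.lowerIntegrand P Λ x a v
          ∂(SensitivityModel.outcomeArmLaw P x)) := by
  have hΛ0 : 0 < Λ := by linarith
  have hle : 1 / Λ ≤ Λ := by rw [div_le_iff₀ hΛ0]; nlinarith
  have hpos : ∀ᵐ x ∂(SensitivityModel.covariateLaw P),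
      ∀ b, 0 < SensitivityModel.armScore P x b := by
    subst hP; exact hMSM.ae_armScore_pos hΛ
  have hint := SensitivityModel.ae_integrable_armLaw P hY a (hpos.mono fun x hx => hx a)
  have hbounds : ∀ Q ∈ SensitivityModel.uncertaintySet k Λ P, _ := fun Q hQ =>
    SensitivityModel.MSM.ae_condMean_bounds P a hΛ hQ.1 hQ.2 hint
  have hformula := SensitivityModel.ae_optimalMean_eq_integral P a hpos hint
  have hu0 : 0 < Λ / (1 + Λ) := by positivity
  have hu1 : Λ / (1 + Λ) < 1 := by rw [div_lt_one (by linarith)]; linarith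
  have hl0 : 0 < 1 / (1 + Λ) := by positivity
  have hl1 : 1 / (1 + Λ) < 1 := by rw [div_lt_one (by linarith)]; linarith
  -- The two quantile levels are the ones at which the extremal weights have mean one.
  have hus : Λ / (1 + Λ) * (1 / Λ) + (1 - Λ / (1 + Λ)) * Λ = 1 := by field_simp; ring
  have hls : 1 / (1 + Λ) * Λ + (1 - 1 / (1 + Λ)) * (1 / Λ) = 1 := by field_simp; ring
  have hΛcases : Λ = 1 ∨ 1 < Λ := (eq_or_lt_of_le hΛ).imp Eq.symm id
  refine ⟨fun Q hQ => (hbounds Q hQ).mono fun x hx => hx.1, ?_, ?_⟩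
  · obtain ⟨Pup, hPup, hmean⟩ := SensitivityModel.exists_mem_uncertaintySet_condMean_eq P a hk hΛ
      hpos hu0 hu1 ⟨le_rfl, hle⟩ ⟨hle, le_rfl⟩ hus
    refine ⟨SensitivityModel.optimalMean P a (Λ / (1 + Λ)) (1 / Λ) Λ,
      ⟨SensitivityModel.measurable_optimalMean P a hu0 hu1, ?_, ?_⟩, ⟨Pup, hPup, hmean⟩, ?_⟩
    · rintro f ⟨Q, hQ, rfl⟩
      exact (hbounds Q hQ).mono fun x hx => (hx.2 _ hu0 hu1).1 hus
    -- The bound is attained within the family, so any other upper bound dominates it.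
    · intro g _ hg
      filter_upwards [hg _ ⟨Pup, hPup, rfl⟩, hmean] with x h1 h2
      rw [← h2]; exact h1
    · filter_upwards [hformula] with x hx hex
      rw [SensitivityModel.upperIntegrand_eq]
      -- For `Λ = 1` the two weights coincide, so exactness of the quantile is not needed.
      refine hx (Λ / (1 + Λ)) (1 / Λ) Λ (hΛcases.imp (fun h => ?_) hex)
      rw [h, div_one]
  · obtain ⟨Plo, hPlo, hmean⟩ := SensitivityModel.exists_mem_uncertaintySet_condMean_eq P a hk hΛ
      hpos hl0 hl1 ⟨hle, le_rfl⟩ ⟨le_rfl, hle⟩ hls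
    refine ⟨SensitivityModel.optimalMean P a (1 / (1 + Λ)) Λ (1 / Λ),
      ⟨SensitivityModel.measurable_optimalMean P a hl0 hl1, ?_, ?_⟩, ⟨Plo, hPlo, hmean⟩, ?_⟩
    · rintro f ⟨Q, hQ, rfl⟩
      exact (hbounds Q hQ).mono fun x hx => (hx.2 _ hl0 hl1).2 hls
    · intro g _ hg
      filter_upwards [hg _ ⟨Plo, hPlo, rfl⟩, hmean] with x h1 h2
      rw [← h2]; exact h1
    · filter_upwards [hformula] with x hx hex
      rw [SensitivityModel.lowerIntegrand_eq]
      refine hx (1 / (1 + Λ)) Λ (1 / Λ) (hΛcases.imp (fun h => ?_) hex)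
      rw [h, div_one]
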